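/- **Setting.** Let $\phi:[0,\infty)\to[0,\infty]$ be convex and lower semicontinuous with $\phi(1)=0$ and $\phi'_\infty:=\lim_{x\to\infty}\phi(x)/x>0$; for nonnegative vectors put $D_\phi(x|y)=\sum_{y_i\neq0}y_i\,\phi(x_i/y_i)+\phi'_\infty\sum_{y_i=0}x_i$, and let $\mathrm{KL}$ be $D_\phi$ for $\phi(x)=x\log x-x+1$. Let $\tau>0$, $\varepsilon\ge 0$, $m\ge1$, and let $u=(1/m,\dots,1/m)$. For $a,b\in\mathbb R_+^m$ with masses $m_a=\sum_i a_i$, $m_b=\sum_i b_i$ and $C\in\mathbb R^{m\times m}$ let $$\mathrm{OT}(a,b,C)=\min_{\Pi\in\mathbb R_+^{m\times m}}\ \langle C,\Pi\rangle+\varepsilon\,\mathrm{KL}(\Pi|a\otimes b)+\tau D_\phi(\Pi\mathbf 1|a)+\tau D_\phi(\Pi^\top\mathbf 1|b).$$ Let $c:\mathbb R^d\times\mathbb R^d\to[0,\infty)$ be a $C^1$ ground cost, and for $X,Y\in(\mathbb R^d)^m$ put $C(X,Y)=(c(x_i,y_j))_{i,j}$. Let $h(X,Y)$ be either the unbalanced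 optimal transport cost $\mathrm{OT}(u,u,C(X,Y))$ (unregularized if $\varepsilon=0$), or the unbalanced Sinkhorn divergence, i.e. the value at $a=b=u$ of $$\mathrm{OT}(a,b,C(X,Y))+\tfrac{\varepsilon}{2}(m_a-m_b)^2-\tfrac12\mathrm{OT}(a,a,C(X,X))-\tfrac12\mathrm{OT}(b,b,C(Y,Y)).$$ If $h$ is the Sinkhorn divergence and $\varepsilon=0$, assume also $c(x,x)=0$ for all $x$. For a function $f$ on an open subset of $\mathbb R^q$ that is Lipschitz near $\theta$, let $f^\circ(\theta;v)=\limsup_{\theta'\to\theta,\,t\downarrow0}\frac{f(\theta'+tv)-f(\theta')}{t}$. The Clarke generalized gradient is $\partial_\theta f=\{\xi:\langle\xi,v\rangle\le f^\circ(\theta;v)\ \forall v\}$, and $f$ is Clarke regular at $\theta$ if for every $v$ its one-sided directional derivative at $\theta$ along $v$ exists and equals $f^\circ(\theta;v)$. The expectation $\mathbb E[F]$ of a random set $F$ is the set of all $\mathbb E[\xi]$ with $\xi$ an integrable random vector such that $\xi\in F$ almost surely. **Theorem.** Let $\Theta\subset\mathbb R^q$ be open, and let $X$ and $Y_\theta$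 $(\theta\in\Theta)$ be compactly supported $(\mathbb R^d)^m$-valued random variables on one probability space such that $\theta\mapsto Y_\theta$ is almost surely $C^1$ on $\Theta$. Assume that every $\theta\in\Theta$ has an open neighbourhood $U\subset\Theta$ and an integrable random variable $K_U$ such that almost surely, for all $\theta_1,\theta_2\in U$, $$\|C(X,Y_{\theta_1})-C(X,Y_{\theta_2})\|\le K_U\|\theta_1-\theta_2\|,$$ and, if $h$ is the Sinkhorn divergence with $\varepsilon>0$, also $$\|C(Y_{\theta_1},Y_{\theta_1})-C(Y_{\theta_2},Y_{\theta_2})\|\le K_U\|\theta_1-\theta_2\|.$$ Then for every $\theta\in\Theta$ $$\partial_\theta\,\mathbb E[h(X,Y_\theta)]=\mathbb E[\partial_\theta h(X,Y_\theta)],$$ and both expectations are finite: $h(X,Y_\theta)$ is almost surely finite and integrable; $\theta'\mapsto h(X,Y_{\theta'})$ is almost surely Lipschitz near $\theta$ and $\partial_\theta h(X,Y_\theta)$ is almost surely contained in a ball about $0$ of integrable random radius; and the two sets above are nonempty and bounded. Moreover $\theta\mapsto-\mathbb E[h(X,Y_\theta)]$ is Lipschitz near every point of $\Theta$ and Clarke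 regular on $\Theta$. -/

import Mathlib

open MeasureTheory Filter Topology
open scoped NNReal ENNReal

noncomputable section

namespace UOT

/-! ### Csiszar divergences and unbalanced optimal transport between weighted point clouds -/

/-- The recession constant `lim_{x → ∞} φ x / x`, with values in `[0, ∞]`.  For a convex `φ` the limit
exists, so that it coincides with the upper limit used here. -/
def recession (φ : ℝ≥0 → ℝ≥0∞) : ℝ≥0∞ :=
  limsup (fun x : ℝ≥0 => φ x / (x : ℝ≥0∞)) atTop

/-- Entropy functions: convex, lower semicontinuous functions `φ : [0, ∞) → [0, ∞]` with `φ 1 = 0` and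
positive recession constant. -/
structure IsEntropy (φ : ℝ≥0 → ℝ≥0∞) : Prop where
  convex : ConvexOn ℝ≥0 Set.univ φ
  lsc : LowerSemicontinuous φ
  map_one : φ 1 = 0
  recession_pos : 0 < recession φ

/-- The Csiszar divergence `D_φ(x, y)` of two nonnegative vectors. -/
def csiszarDiv {ι : Type*} [Fintype ι] (φ : ℝ≥0 → ℝ≥0∞) (x y : ι → ℝ≥0) : ℝ≥0∞ :=
  ∑ i, if y i = 0 then recession φ * (x i : ℝ≥0∞) else (y i : ℝ≥0∞) * φ (x i / y i)

/-- The entropy `x log x - x + 1`, equal to `1` at `x = 0`. -/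
def klEntropy (x : ℝ≥0) : ℝ≥0∞ :=
  ENNReal.ofReal ((x : ℝ) * Real.log x - x + 1)

/-- The Kullback-Leibler divergence of two nonnegative vectors,
`∑ i, x i * log (x i / y i) - x i + y i`. -/
def klDiv {ι : Type*} [Fintype ι] (x y : ι → ℝ≥0) : ℝ≥0∞ :=
  csiszarDiv klEntropy x y

/-- The energy
`⟨C, Π⟩ + τ D_φ(Π 1, a) + τ D_φ(Πᵀ 1, b) + ε KL(Π, a ⊗ b)` of a nonnegative plan `Π`. -/
def uotEnergy {ι : Type*} [Fintype ι] (φ : ℝ≥0 → ℝ≥0∞) (τ ε : ℝ≥0) (a b : ι → ℝ≥0)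
    (C : Matrix ι ι ℝ) (plan : Matrix ι ι ℝ≥0) : EReal :=
  ((∑ i, ∑ j, C i j * (plan i j : ℝ) : ℝ) : EReal) +
    (((τ : ℝ≥0∞) * csiszarDiv φ (fun i => ∑ j, plan i j) a
      + (τ : ℝ≥0∞) * csiszarDiv φ (fun j => ∑ i, plan i j) b
      + (ε : ℝ≥0∞) * klDiv (fun p : ι × ι => plan p.1 p.2) (fun p => a p.1 * b p.2) : ℝ≥0∞) : EReal)

/-- The unbalanced optimal transport cost (unregularized for `ε = 0`): the minimal energy of a plan. -/
def uot {ι : Type*} [Fintype ι] (φ : ℝ≥0 → ℝ≥0∞) (τ ε : ℝ≥0) (a b : ι → ℝ≥0)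
    (C : Matrix ι ι ℝ) : EReal :=
  ⨅ plan : Matrix ι ι ℝ≥0, uotEnergy φ τ ε a b C plan

/-- The matrix of the costs `c (x i) (y j)` between two tuples of points. -/
def costMatrix {ι E : Type*} (c : E → E → ℝ) (x y : ι → E) : Matrix ι ι ℝ :=
  Matrix.of fun i j => c (x i) (y j)

/-- The unbalanced Sinkhorn divergence between the weighted point clouds `∑ i, a i δ_{x i}` and
`∑ j, b j δ_{y j}`.  It is a finite number if and only if its three transport costs are. -/
def sinkhornDiv {ι E : Type*} [Fintype ι] (φ : ℝ≥0 → ℝ≥0∞) (τ ε : ℝ≥0) (a b : ι → ℝ≥0)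
    (c : E → E → ℝ) (x y : ι → E) : EReal :=
  uot φ τ ε a b (costMatrix c x y)
    + (((ε : ℝ) / 2 * ((∑ i, (a i : ℝ)) - ∑ i, (b i : ℝ)) ^ 2 : ℝ) : EReal)
    - ((1 / 2 : ℝ) : EReal) * uot φ τ ε a a (costMatrix c x x)
    - ((1 / 2 : ℝ) : EReal) * uot φ τ ε b b (costMatrix c y y)

/-- The two losses: unbalanced optimal transport and the unbalanced Sinkhorn divergence. -/
inductive LossKind where
  | transport
  | sinkhorn

/-- The loss between two weighted point clouds for a ground cost `c`. -/
def loss {ι E : Type*} [Fintype ι] (L : LossKind) (φ : ℝ≥0 → ℝ≥0∞) (τ ε : ℝ≥0)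
    (a b : ι → ℝ≥0) (c : E → E → ℝ) (x y : ι → E) : EReal :=
  match L with
  | LossKind.transport => uot φ τ ε a b (costMatrix c x y)
  | LossKind.sinkhorn => sinkhornDiv φ τ ε a b c x y

/-- The uniform probability vector of length `m`. -/
def uniformVec (m : ℕ) : Fin m → ℝ≥0 := fun _ => (m : ℝ≥0)⁻¹

/-! ### Clarke's generalized gradients -/

/-- `f` is Lipschitz on a neighbourhood of `x`. -/
def LipschitzNear {E : Type*} [PseudoEMetricSpace E] (f : E → ℝ) (x : E) : Prop :=
  ∃ K : ℝ≥0, ∃ U ∈ 𝓝 x, LipschitzOnWith K f U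

/-- Clarke's generalized directional derivative
`f°(x; v) = limsup_{y → x, t ↓ 0} (f (y + t v) - f y) / t`. -/
def clarkeDeriv {E : Type*} [NormedAddCommGroup E] [InnerProductSpace ℝ E]
    (f : E → ℝ) (x v : E) : EReal :=
  limsup (fun p : E × ℝ => (((f (p.1 + p.2 • v) - f p.1) / p.2 : ℝ) : EReal))
    (𝓝 x ×ˢ 𝓝[>] (0 : ℝ))

/-- Clarke's generalized gradient: all `ξ` with `⟨ξ, v⟩ ≤ f°(x; v)` for every direction `v`. -/
def clarkeGradient {E : Type*} [NormedAddCommGroup E] [InnerProductSpace ℝ E]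
    (f : E → ℝ) (x : E) : Set E :=
  {ξ | ∀ v : E, ((inner ℝ ξ v : ℝ) : EReal) ≤ clarkeDeriv f x v}

/-- Clarke regularity at `x`: `f` is Lipschitz near `x`, and for every `v` the one-sided directional
derivative of `f` at `x` along `v` exists and equals `f°(x; v)`. -/
def ClarkeRegularAt {E : Type*} [NormedAddCommGroup E] [InnerProductSpace ℝ E]
    (f : E → ℝ) (x : E) : Prop :=
  LipschitzNear f x ∧
    ∀ v : E, Tendsto (fun t : ℝ => (((f (x + t • v) - f x) / t : ℝ) : EReal)) (𝓝[>] 0)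
      (𝓝 (clarkeDeriv f x v))

/-- The (Aumann) expectation of a random set: the expectations of its integrable selections. -/
def setExpectation {Ω E : Type*} [MeasurableSpace Ω] [NormedAddCommGroup E] [NormedSpace ℝ E]
    (P : Measure Ω) (F : Ω → Set E) : Set E :=
  {z | ∃ ξ : Ω → E, Integrable ξ P ∧ (∀ᵐ ω ∂P, ξ ω ∈ F ω) ∧ ∫ ω, ξ ω ∂P = z}

end UOT

end

/-!
Transport costs are infima of functions that are affine in the cost matrix `C`, hence concave in `C`.
For `0 ≤ C` only plans with entries at most `1 / m` matter, because truncating a plan at `1 / m` lowers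
neither a marginal nor an entry below the value at which entropies start to increase
(`planPenalty_truncate_le`).  So on nonnegative matrices the cost agrees with one concave function that
is finite and Lipschitz on all matrices (`uot_eq_lowerEnvelope`), and the integrable Lipschitz bounds on
the cost matrices pass to the loss.

The negative of the transport loss is therefore a Lipschitz convex function of a `C¹` map, and such
functions are Clarke regular (`HasRegularDeriv.exists_of_convexOn_comp`).  In the Sinkhorn divergence
the self-cost of `Y_θ` enters with the opposite sign.  For `0 < ε` the Kullback-Leibler term makes the
energy strongly convex on the truncated plans, so that nearly optimal plans converge and the cost is
strictly differentiable (`IsBoundedFamily.exists_hasStrictFDerivAt`); for `ε = 0` the self-cost is `0`.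

Regularity makes generalized gradients and expectations commute (`clarkeGradient_integral`).  By dominated
convergence the directional derivative of the expectation is the expectation of the directional
derivatives `σ_ω`, and it bounds the limits of the difference quotients at nearby points
(`hasRegularDeriv_integral`).  The generalized gradients are the sets of linear minorants of these
sublinear functions, and a linear minorant of `E[σ_ω]` is the expectation of an integrable selection of
linear minorants of the `σ_ω`, by a Hahn-Banach extension in `L²` and the Riesz representation
(`IsRandomSublinear.exists_selection`).
-/

namespace UOT

/-! ### Regular directional derivatives -/

section RegularDeriv

variable {E V : Type*} [NormedAddCommGroup E] [InnerProductSpace ℝ E]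
  [NormedAddCommGroup V] [NormedSpace ℝ V]

/-- `σ` is the one-sided directional derivative of `f` at `x`, and it dominates the upper limit of the
difference quotients based at points near `x`.  For a function that is Lipschitz near `x` this says
that `f` is Clarke regular at `x` with real-valued directional derivative `σ`. -/
structure HasRegularDeriv (f : E → ℝ) (x : E) (σ : E → ℝ) : Prop where
  tendsto : ∀ v, Tendsto (fun t : ℝ => (f (x + t • v) - f x) / t) (𝓝[>] 0) (𝓝 (σ v))
  eventually_lt : ∀ v, ∀ r, σ v < r →
    ∀ᶠ p : E × ℝ in 𝓝 x ×ˢ 𝓝[>] 0, (f (p.1 + p.2 • v) - f p.1) / p.2 < r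

theorem tendsto_base_prod (x v : E) :
    Tendsto (fun t : ℝ => (x + t • v, t)) (𝓝[>] 0) (𝓝 x ×ˢ 𝓝[>] 0) := by
  refine Tendsto.prodMk ?_ tendsto_id
  have : Tendsto (fun t : ℝ => x + t • v) (𝓝 0) (𝓝 (x + (0 : ℝ) • v)) :=
    Continuous.tendsto (by fun_prop) _
  rw [zero_smul, add_zero] at this
  exact this.mono_left nhdsWithin_le_nhds

theorem tendsto_translate_prod (x v : E) :
    Tendsto (fun p : E × ℝ => (p.1 + p.2 • v, p.2)) (𝓝 x ×ˢ 𝓝[>] 0) (𝓝 x ×ˢ 𝓝[>] 0) := by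
  refine Tendsto.prodMk ?_ tendsto_snd
  have : Tendsto (fun p : E × ℝ => p.1 + p.2 • v) (𝓝 (x, 0)) (𝓝 (x + (0 : ℝ) • v)) :=
    Continuous.tendsto (by fun_prop) (x, (0 : ℝ))
  rw [zero_smul, add_zero, nhds_prod_eq] at this
  exact this.mono_left (Filter.prod_mono le_rfl nhdsWithin_le_nhds)

theorem eventually_snd_pos {A : Type*} [TopologicalSpace A] (x : A) :
    ∀ᶠ p : A × ℝ in 𝓝 x ×ˢ 𝓝[>] 0, 0 < p.2 :=
  tendsto_snd.eventually (self_mem_nhdsWithin : Set.Ioi (0 : ℝ) ∈ 𝓝[>] 0)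

theorem HasRegularDeriv.clarkeDeriv_eq {f : E → ℝ} {x : E} {σ : E → ℝ}
    (h : HasRegularDeriv f x σ) (v : E) : clarkeDeriv f x v = (σ v : EReal) := by
  unfold clarkeDeriv
  apply le_antisymm
  · refine EReal.le_of_forall_lt_iff_le.1 fun r hr => ?_
    refine limsup_le_of_le (by isBoundedDefault) ?_
    filter_upwards [h.eventually_lt v r (by exact_mod_cast hr)] with p hp
    exact_mod_cast hp.le
  · have h1 : Tendsto (fun t : ℝ => (((f (x + t • v) - f x) / t : ℝ) : EReal)) (𝓝[>] 0)
        (𝓝 (σ v : EReal)) := (continuous_coe_real_ereal.tendsto _).comp (h.tendsto v)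
    rw [← h1.limsup_eq]
    have h2 : Tendsto (fun t : ℝ => (x, t)) (𝓝[>] 0) (𝓝 x ×ˢ 𝓝[>] 0) :=
      tendsto_const_nhds.prodMk tendsto_id
    have := limsup_le_limsup_of_le (u := fun p : E × ℝ =>
      (((f (p.1 + p.2 • v) - f p.1) / p.2 : ℝ) : EReal)) h2 (by isBoundedDefault)
        (by isBoundedDefault)
    exact this

/-- The base point of the difference quotients may be moved to the other end of the segment. -/
theorem clarkeDeriv_neg (f : E → ℝ) (x v : E) :
    clarkeDeriv (fun y => -f y) x v = clarkeDeriv f x (-v) := by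
  have key : map (fun p : E × ℝ => (p.1 + p.2 • v, p.2)) (𝓝 x ×ˢ 𝓝[>] 0)
      = 𝓝 x ×ˢ 𝓝[>] 0 := by
    refine map_eq_of_inverse (ψ := fun p : E × ℝ => (p.1 + p.2 • (-v), p.2)) ?_
      (tendsto_translate_prod x v) (tendsto_translate_prod x (-v))
    funext p
    simp
  unfold clarkeDeriv
  conv_rhs => rw [← key]
  rw [limsup, limsup, map_map]
  congr 2
  funext p
  simp only [Function.comp, smul_neg, add_neg_cancel_right]
  congr 2
  ring

theorem HasRegularDeriv.add {f g : E → ℝ} {x : E} {σ τ : E → ℝ}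
    (hf : HasRegularDeriv f x σ) (hg : HasRegularDeriv g x τ) :
    HasRegularDeriv (fun y => f y + g y) x (fun v => σ v + τ v) where
  tendsto v := by
    refine ((hf.tendsto v).add (hg.tendsto v)).congr fun t => ?_
    ring
  eventually_lt v r hr := by
    have h1 := hf.eventually_lt v (σ v + (r - (σ v + τ v)) / 2) (by linarith)
    have h2 := hg.eventually_lt v (τ v + (r - (σ v + τ v)) / 2) (by linarith)
    filter_upwards [h1, h2] with p h1 h2
    have : (f (p.1 + p.2 • v) + g (p.1 + p.2 • v) - (f p.1 + g p.1)) / p.2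
      = (f (p.1 + p.2 • v) - f p.1) / p.2 + (g (p.1 + p.2 • v) - g p.1) / p.2 := by ring
    linarith

theorem HasRegularDeriv.congr {f g : E → ℝ} {x : E} {σ : E → ℝ} (hf : HasRegularDeriv f x σ)
    (h : f =ᶠ[𝓝 x] g) : HasRegularDeriv g x σ where
  tendsto v := by
    refine (hf.tendsto v).congr' ?_
    filter_upwards [(tendsto_fst.comp (tendsto_base_prod x v)).eventually h] with t ht
    simp only [Function.comp] at ht
    rw [ht, h.eq_of_nhds]
  eventually_lt v r hr := by
    filter_upwards [hf.eventually_lt v r hr, tendsto_fst.eventually h,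
      (tendsto_fst.comp (tendsto_translate_prod x v)).eventually h] with p hp h1 h2
    simp only [Function.comp] at h2
    rwa [h1, h2] at hp

theorem HasRegularDeriv.smul_eq {f : E → ℝ} {x : E} {σ : E → ℝ} (h : HasRegularDeriv f x σ)
    {a : ℝ} (ha : 0 < a) (v : E) : σ (a • v) = a * σ v := by
  have h1 : Tendsto (fun t : ℝ => t * a) (𝓝[>] 0) (𝓝[>] 0) := by
    refine tendsto_nhdsWithin_iff.2 ⟨?_, ?_⟩
    · have : Tendsto (fun t : ℝ => t * a) (𝓝 0) (𝓝 (0 * a)) := Continuous.tendsto (by fun_prop) _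
      rw [zero_mul] at this
      exact this.mono_left nhdsWithin_le_nhds
    · filter_upwards [self_mem_nhdsWithin] with t (ht : 0 < t)
      exact mul_pos ht ha
  have h2 := ((h.tendsto v).comp h1).const_mul a
  refine tendsto_nhds_unique ((h.tendsto (a • v)).congr' ?_) h2
  filter_upwards [self_mem_nhdsWithin] with t (ht : 0 < t)
  simp only [Function.comp, smul_smul]
  field_simp

theorem HasRegularDeriv.add_le {f : E → ℝ} {x : E} {σ : E → ℝ} (h : HasRegularDeriv f x σ)
    (v w : E) : σ (v + w) ≤ σ v + σ w := by
  refine le_of_forall_pos_le_add fun e he => ?_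
  have h1 := (h.tendsto v).add_const (σ w + e)
  rw [← add_assoc] at h1
  refine le_of_tendsto_of_tendsto (h.tendsto (v + w)) h1 ?_
  filter_upwards [(tendsto_base_prod x v).eventually (h.eventually_lt w (σ w + e) (by linarith))]
    with t ht
  have : (f (x + t • (v + w)) - f x) / t
      = (f (x + t • v) - f x) / t + (f (x + t • v + t • w) - f (x + t • v)) / t := by
    rw [smul_add, add_assoc]
    ring
  rw [this]
  linarith

theorem HasRegularDeriv.abs_le {f : E → ℝ} {x : E} {σ : E → ℝ} (h : HasRegularDeriv f x σ)
    {U : Set E} (hU : U ∈ 𝓝 x) {K : ℝ} (hK : ∀ y ∈ U, ∀ z ∈ U, |f y - f z| ≤ K * ‖y - z‖) (v : E) :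
    |σ v| ≤ K * ‖v‖ := by
  refine le_of_tendsto (h.tendsto v).abs ?_
  filter_upwards [self_mem_nhdsWithin,
    (tendsto_fst.comp (tendsto_base_prod x v)).eventually hU] with t (ht : 0 < t) hU'
  rw [abs_div, abs_of_pos ht, div_le_iff₀ ht]
  refine (hK _ hU' _ (mem_of_mem_nhds hU)).trans ?_
  simp only [Function.comp]
  rw [add_sub_cancel_left, norm_smul, Real.norm_of_nonneg ht.le]
  exact le_of_eq (by ring)

theorem tendsto_quotient_of_hasStrictFDerivAt {F : E → V} {F' : E →L[ℝ] V} {x : E}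
    (h : HasStrictFDerivAt F F' x) (v : E) :
    Tendsto (fun p : E × ℝ => p.2⁻¹ • (F (p.1 + p.2 • v) - F p.1)) (𝓝 x ×ˢ 𝓝[>] 0)
      (𝓝 (F' v)) := by
  have h1 : Tendsto (fun p : E × ℝ => (p.1 + p.2 • v, p.1)) (𝓝 x ×ˢ 𝓝[>] 0) (𝓝 (x, x)) := by
    rw [nhds_prod_eq]
    exact (tendsto_fst.comp (tendsto_translate_prod x v)).prodMk tendsto_fst
  have h2 := h.isLittleO.comp_tendsto h1
  rw [tendsto_iff_norm_sub_tendsto_zero]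
  rw [Metric.tendsto_nhds]
  intro e he
  have hc : 0 < e / (‖v‖ + 1) := by positivity
  filter_upwards [h2.def hc, eventually_snd_pos x] with p hp hp2
  simp only [Function.comp, add_sub_cancel_left, map_smul, norm_smul,
    Real.norm_of_nonneg hp2.le] at hp
  have h3 : p.2⁻¹ • (F (p.1 + p.2 • v) - F p.1) - F' v
      = p.2⁻¹ • (F (p.1 + p.2 • v) - F p.1 - p.2 • F' v) := by
    rw [smul_sub _ _ (p.2 • F' v), inv_smul_smul₀ hp2.ne']
  rw [Real.dist_eq, sub_zero, abs_norm, h3, norm_smul, norm_inv, Real.norm_of_nonneg hp2.le,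
    inv_mul_lt_iff₀ hp2]
  refine hp.trans_lt ?_
  have : e / (‖v‖ + 1) * (p.2 * ‖v‖) = p.2 * (e * (‖v‖ / (‖v‖ + 1))) := by ring
  rw [this]
  have h4 : ‖v‖ / (‖v‖ + 1) < 1 := (div_lt_one (by positivity)).2 (by linarith)
  exact mul_lt_mul_of_pos_left (by nlinarith) hp2

theorem HasRegularDeriv.of_hasStrictFDerivAt {f : E → ℝ} {f' : E →L[ℝ] ℝ} {x : E}
    (h : HasStrictFDerivAt f f' x) : HasRegularDeriv f x f' := by
  have key : ∀ v, Tendsto (fun p : E × ℝ => (f (p.1 + p.2 • v) - f p.1) / p.2)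
      (𝓝 x ×ˢ 𝓝[>] 0) (𝓝 (f' v)) := fun v => by
    refine (tendsto_quotient_of_hasStrictFDerivAt h v).congr fun p => ?_
    rw [smul_eq_mul, div_eq_inv_mul]
  exact ⟨fun v => (key v).comp (tendsto_const_nhds.prodMk tendsto_id),
    fun v r hr => (key v).eventually_lt_const hr⟩

/-- A Lipschitz convex function after a strictly differentiable map is regular: secant slopes of the
convex function decrease as the step shrinks, and a slope with a fixed step depends continuously on the
base point. -/
theorem HasRegularDeriv.exists_of_convexOn_comp {k : V → ℝ} (hk : ConvexOn ℝ Set.univ k)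
    {K : ℝ} (hK : ∀ y z, |k y - k z| ≤ K * ‖y - z‖) {F : E → V} {F' : E →L[ℝ] V} {x : E}
    (hF : HasStrictFDerivAt F F' x) : ∃ σ, HasRegularDeriv (fun y => k (F y)) x σ := by
  have hconv : ∀ y w : V, ConvexOn ℝ Set.univ (fun s : ℝ => k (y + s • w)) := fun y w => by
    have := (hk.comp_affineMap (AffineMap.lineMap (k := ℝ) y (y + w)))
    simpa [AffineMap.lineMap_apply, Function.comp_def, add_comm] using this
  have hkc : Continuous k := by
    refine continuous_iff_continuousAt.2 fun y => ?_
    rw [ContinuousAt, tendsto_iff_norm_sub_tendsto_zero]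
    have h0 : Tendsto (fun z : V => K * ‖z - y‖) (𝓝 y) (𝓝 0) := by
      have : Tendsto (fun z : V => K * ‖z - y‖) (𝓝 y) (𝓝 (K * ‖y - y‖)) :=
        Continuous.tendsto (by fun_prop) _
      simpa using this
    exact squeeze_zero (fun _ => norm_nonneg _) (fun z => hK z y) h0
  have hdir : ∀ w : V, ∃ s : ℝ, Tendsto (fun t : ℝ => (k (F x + t • w) - k (F x)) / t) (𝓝[>] 0)
      (𝓝 s) := fun w => by
    have h1 := (hconv (F x) w).hasDerivWithinAt_rightDeriv_of_mem_interior (x := 0) (by simp)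
    refine ⟨_, ((hasDerivWithinAt_iff_tendsto_slope' (by simp)).1 h1).congr fun t => ?_⟩
    simp [slope_def_field]
  choose σ hσ using hdir
  -- replacing the increment of `F` by its linearization changes the quotients by `o(1)`
  have herr : ∀ v, Tendsto (fun p : E × ℝ =>
      (k (F (p.1 + p.2 • v)) - k (F p.1 + p.2 • F' v)) / p.2) (𝓝 x ×ˢ 𝓝[>] 0) (𝓝 0) := fun v => by
    have h1 := ((tendsto_quotient_of_hasStrictFDerivAt hF v).sub_const (F' v)).norm.const_mul K
    rw [sub_self, norm_zero, mul_zero] at h1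
    refine squeeze_zero_norm' ?_ h1
    filter_upwards [eventually_snd_pos x] with p hp
    rw [norm_div, Real.norm_of_nonneg hp.le, div_le_iff₀ hp]
    refine (hK _ _).trans (le_of_eq ?_)
    have : F (p.1 + p.2 • v) - (F p.1 + p.2 • F' v)
        = p.2 • (p.2⁻¹ • (F (p.1 + p.2 • v) - F p.1) - F' v) := by
      rw [smul_sub p.2, smul_inv_smul₀ hp.ne']
      abel
    rw [this, norm_smul, Real.norm_of_nonneg hp.le]
    ring
  refine ⟨fun v => σ (F' v), fun v => ?_, fun v r hr => ?_⟩
  · have h1 := (herr v).comp (tendsto_const_nhds.prodMk tendsto_id :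
      Tendsto (fun t : ℝ => (x, t)) (𝓝[>] 0) (𝓝 x ×ˢ 𝓝[>] 0))
    have h2 := h1.add (hσ (F' v))
    rw [zero_add] at h2
    refine h2.congr fun t => ?_
    simp only [Function.comp]
    ring
  · obtain ⟨r', hr1, hr2⟩ := exists_between hr
    obtain ⟨s, hs, hs0⟩ := (((hσ (F' v)).eventually_lt_const hr1).and
      (self_mem_nhdsWithin : Set.Ioi (0 : ℝ) ∈ 𝓝[>] 0)).exists
    have hs0 : 0 < s := hs0
    have h1 : ∀ᶠ p : E × ℝ in 𝓝 x ×ˢ 𝓝[>] 0, (k (F p.1 + s • F' v) - k (F p.1)) / s < r' := by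
      have : Tendsto (fun y => (k (y + s • F' v) - k y) / s) (𝓝 (F x))
          (𝓝 ((k (F x + s • F' v) - k (F x)) / s)) := Continuous.tendsto (by fun_prop) _
      exact ((this.comp hF.continuousAt).comp tendsto_fst).eventually_lt_const hs
    have h2 : ∀ᶠ p : E × ℝ in 𝓝 x ×ˢ 𝓝[>] 0, p.2 < s :=
      tendsto_snd.eventually (nhdsWithin_le_nhds (Iio_mem_nhds hs0))
    filter_upwards [h1, h2, eventually_snd_pos x,
      (herr v).eventually_lt_const (sub_pos.2 hr2)] with p h1 h2 h3 h4
    have h5 := (hconv (F p.1) (F' v)).secant_mono (a := 0) (x := p.2) (y := s) trivial trivial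
      trivial h3.ne' hs0.ne' h2.le
    simp only [zero_smul, add_zero, sub_zero] at h5
    have h6 : (k (F (p.1 + p.2 • v)) - k (F p.1)) / p.2
      = (k (F (p.1 + p.2 • v)) - k (F p.1 + p.2 • F' v)) / p.2
        + (k (F p.1 + p.2 • F' v) - k (F p.1)) / p.2 := by ring
    linarith

end RegularDeriv

/-! ### Infima of affine functions -/

section LowerEnvelope

variable {V : Type*} [NormedAddCommGroup V] [NormedSpace ℝ V]

/-- The infimum of the affine functions `x ↦ ℓ x + r` over the pairs `(ℓ, r)` in `S`. -/
noncomputable def lowerEnvelope (S : Set ((V →L[ℝ] ℝ) × ℝ)) (x : V) : ℝ :=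
  ⨅ s : S, (s.1.1 x + s.1.2)

/-- A nonempty set of affine functions with bounded linear parts and nonnegative constant terms. -/
structure IsBoundedFamily (S : Set ((V →L[ℝ] ℝ) × ℝ)) (M : ℝ) : Prop where
  nonempty : S.Nonempty
  norm_le : ∀ s ∈ S, ‖s.1‖ ≤ M
  nonneg : ∀ s ∈ S, 0 ≤ s.2

variable {S : Set ((V →L[ℝ] ℝ) × ℝ)} {M : ℝ}

theorem IsBoundedFamily.lowerEnvelope_le (hS : IsBoundedFamily S M) (x : V) {s} (hs : s ∈ S) :
    lowerEnvelope S x ≤ s.1 x + s.2 := by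
  refine ciInf_le ⟨-(M * ‖x‖), ?_⟩ (⟨s, hs⟩ : S)
  rintro _ ⟨t, rfl⟩
  have h1 := (abs_le.1 (t.1.1.le_opNorm x)).1
  have h2 := mul_le_mul_of_nonneg_right (hS.norm_le _ t.2) (norm_nonneg x)
  have h3 := hS.nonneg _ t.2
  simp only
  linarith

theorem IsBoundedFamily.exists_lt (hS : IsBoundedFamily S M) (x : V) {e : ℝ} (he : 0 < e) :
    ∃ s ∈ S, s.1 x + s.2 < lowerEnvelope S x + e := by
  have := hS.nonempty.to_subtype
  obtain ⟨s, hs⟩ := exists_lt_of_ciInf_lt (lt_add_of_pos_right (lowerEnvelope S x) he)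
  exact ⟨s.1, s.2, hs⟩

theorem IsBoundedFamily.le_lowerEnvelope (hS : IsBoundedFamily S M) {x : V} {b : ℝ}
    (h : ∀ s ∈ S, b ≤ s.1 x + s.2) : b ≤ lowerEnvelope S x := by
  have := hS.nonempty.to_subtype
  exact le_ciInf fun s => h s.1 s.2

theorem IsBoundedFamily.sub_le (hS : IsBoundedFamily S M) (x y : V) :
    lowerEnvelope S x - lowerEnvelope S y ≤ M * ‖x - y‖ := by
  rw [sub_le_comm]
  refine hS.le_lowerEnvelope fun s hs => ?_
  have h1 := hS.lowerEnvelope_le x hs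
  have h2 := (le_abs_self _).trans (s.1.le_opNorm (x - y))
  have h3 := mul_le_mul_of_nonneg_right (hS.norm_le _ hs) (norm_nonneg (x - y))
  rw [map_sub] at h2
  linarith

theorem IsBoundedFamily.abs_sub_le (hS : IsBoundedFamily S M) (x y : V) :
    |lowerEnvelope S x - lowerEnvelope S y| ≤ M * ‖x - y‖ := by
  refine abs_le.2 ⟨?_, hS.sub_le x y⟩
  have := hS.sub_le y x
  rw [norm_sub_rev] at this
  linarith

theorem IsBoundedFamily.continuous (hS : IsBoundedFamily S M) : Continuous (lowerEnvelope S) := by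
  refine (LipschitzWith.of_dist_le_mul (K := M.toNNReal) fun x y => ?_).continuous
  rw [Real.dist_eq, dist_eq_norm]
  exact (hS.abs_sub_le x y).trans
    (mul_le_mul_of_nonneg_right (Real.le_coe_toNNReal M) (norm_nonneg _))

theorem IsBoundedFamily.convexOn_neg (hS : IsBoundedFamily S M) :
    ConvexOn ℝ Set.univ (fun x => -lowerEnvelope S x) := by
  refine ⟨convex_univ, fun x _ y _ a b ha hb hab => ?_⟩
  rw [smul_neg, smul_neg, ← neg_add, neg_le_neg_iff]
  refine hS.le_lowerEnvelope fun s hs => ?_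
  have h1 := mul_le_mul_of_nonneg_left (hS.lowerEnvelope_le x hs) ha
  have h2 := mul_le_mul_of_nonneg_left (hS.lowerEnvelope_le y hs) hb
  have h3 : s.2 = a * s.2 + b * s.2 := by rw [← add_mul, hab, one_mul]
  simp only [smul_eq_mul, map_add, map_smul]
  linarith

/-- If midpoints of the family gain a quadratic amount, nearly optimal members for nearby arguments
are close to each other. -/
theorem IsBoundedFamily.norm_sub_sq_le (hS : IsBoundedFamily S M) {κ : ℝ}
    (hmid : ∀ s ∈ S, ∀ t ∈ S, ∃ r, ((1 / 2 : ℝ) • (s.1 + t.1), r) ∈ S ∧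
      r + κ * ‖s.1 - t.1‖ ^ 2 ≤ (s.2 + t.2) / 2)
    {x y : V} {a b : ℝ} {s t : (V →L[ℝ] ℝ) × ℝ} (hs : s ∈ S) (ht : t ∈ S)
    (hsx : s.1 x + s.2 ≤ lowerEnvelope S x + a) (hty : t.1 y + t.2 ≤ lowerEnvelope S y + b) :
    κ * ‖s.1 - t.1‖ ^ 2 ≤ a + b + M * ‖x - y‖ := by
  obtain ⟨r, hr, hr'⟩ := hmid s hs t ht
  have h1 := hS.lowerEnvelope_le x hr
  have h2 := hS.sub_le y x
  have h3 := (abs_le.1 (t.1.le_opNorm (x - y))).2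
  have h4 := mul_le_mul_of_nonneg_right (hS.norm_le _ ht) (norm_nonneg (x - y))
  have h5 := (abs_nonneg _).trans (hS.abs_sub_le x y)
  have h6 := hS.lowerEnvelope_le x hs
  rw [norm_sub_rev] at h2
  simp only [smul_apply, add_apply, smul_eq_mul] at h1
  rw [map_sub] at h3
  have h7 := hS.lowerEnvelope_le y ht
  linarith

/-- A lower envelope of a uniformly midpoint-convex family is strictly differentiable: the linear parts
of nearly optimal members converge, and their limit is the derivative. -/
theorem IsBoundedFamily.exists_hasStrictFDerivAt (hS : IsBoundedFamily S M) {κ : ℝ} (hκ : 0 < κ)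
    (hmid : ∀ s ∈ S, ∀ t ∈ S, ∃ r, ((1 / 2 : ℝ) • (s.1 + t.1), r) ∈ S ∧
      r + κ * ‖s.1 - t.1‖ ^ 2 ≤ (s.2 + t.2) / 2) (x : V) :
    ∃ g : V →L[ℝ] ℝ, HasStrictFDerivAt (lowerEnvelope S) g x := by
  choose s hs hsx using fun n : ℕ => hS.exists_lt x (Nat.one_div_pos_of_nat (α := ℝ) (n := n))
  have hcau : CauchySeq fun n => (s n).1 := by
    refine Metric.cauchySeq_iff'.2 fun e he => ?_
    obtain ⟨N, hN⟩ := exists_nat_one_div_lt (show (0 : ℝ) < κ * e ^ 2 / 2 by positivity)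
    refine ⟨N, fun n hn => ?_⟩
    have h1 := hS.norm_sub_sq_le hmid (hs n) (hs N) (hsx n).le (hsx N).le
    have h2 : 1 / ((n : ℝ) + 1) ≤ 1 / ((N : ℝ) + 1) := Nat.one_div_le_one_div hn
    rw [sub_self, norm_zero, mul_zero, add_zero] at h1
    rw [dist_eq_norm]
    refine lt_of_pow_lt_pow_left₀ 2 he.le (lt_of_mul_lt_mul_left ?_ hκ.le)
    linarith
  obtain ⟨g, hg⟩ := cauchySeq_tendsto_of_complete hcau
  have hclose : ∀ y : V, ∀ b : ℝ, ∀ t ∈ S, t.1 y + t.2 ≤ lowerEnvelope S y + b →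
      κ * ‖t.1 - g‖ ^ 2 ≤ b + M * ‖x - y‖ := fun y b t ht hty => by
    have h1 : Tendsto (fun n => κ * ‖(s n).1 - t.1‖ ^ 2) atTop (𝓝 (κ * ‖g - t.1‖ ^ 2)) :=
      ((hg.sub_const t.1).norm.pow 2).const_mul κ
    have h2 : Tendsto (fun n : ℕ => 1 / ((n : ℝ) + 1) + b + M * ‖x - y‖) atTop
        (𝓝 (0 + b + M * ‖x - y‖)) :=
      (tendsto_one_div_add_atTop_nhds_zero_nat.add_const b).add_const _
    have h3 := le_of_tendsto_of_tendsto' h1 h2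
      fun n => hS.norm_sub_sq_le hmid (hs n) ht (hsx n).le hty
    rwa [norm_sub_rev, zero_add] at h3
  have hM : 0 ≤ M := (norm_nonneg _).trans (hS.norm_le _ (hs 0))
  -- one-sided estimate, with slack `e * ‖z - y‖` in the choice of the member at `y`
  have key : ∀ e : ℝ, 0 < e → ∃ δ > 0, ∀ y z : V, ‖y - x‖ < δ → ‖z - x‖ < δ →
      lowerEnvelope S z - lowerEnvelope S y - g (z - y) ≤ e * ‖z - y‖ := fun e he => by
    have he2 : 0 < κ * (e / 2) ^ 2 := by positivity
    refine ⟨κ * (e / 2) ^ 2 / (M + e + 1), by positivity, fun y z hy hz => ?_⟩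
    rcases eq_or_ne z y with rfl | hne
    · simp
    have hzy : 0 < ‖z - y‖ := norm_pos_iff.2 (sub_ne_zero.2 hne)
    obtain ⟨t, ht, hty⟩ := hS.exists_lt y (e := e / 2 * ‖z - y‖) (by positivity)
    have h1 := hclose y _ t ht hty.le
    have h2 : ‖z - y‖ ≤ ‖z - x‖ + ‖y - x‖ := by
      rw [norm_sub_rev y x]
      exact norm_sub_le_norm_sub_add_norm_sub z x y
    rw [norm_sub_rev x y] at h1
    rw [lt_div_iff₀ (by positivity)] at hy hz
    have h3 : ‖t.1 - g‖ ≤ e / 2 := by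
      refine le_of_sq_le_sq ?_ (by positivity)
      refine le_of_mul_le_mul_left ?_ hκ
      have h4 : e / 2 * ‖z - y‖ ≤ e / 2 * (‖z - x‖ + ‖y - x‖) :=
        mul_le_mul_of_nonneg_left h2 (by positivity)
      nlinarith [norm_nonneg (y - x), norm_nonneg (z - x),
        mul_nonneg hM (norm_nonneg (z - x))]
    have h4 := hS.lowerEnvelope_le z ht
    have h5 := (le_abs_self _).trans ((t.1 - g).le_opNorm (z - y))
    have h6 := mul_le_mul_of_nonneg_right h3 (norm_nonneg (z - y))
    simp only [sub_apply] at h5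
    have h7 : t.1 (z - y) = t.1 z - t.1 y := map_sub _ _ _
    linarith
  refine ⟨g, .of_isLittleO ?_⟩
  refine Asymptotics.isLittleO_iff.2 fun e he => ?_
  obtain ⟨δ, hδ, h⟩ := key e he
  filter_upwards [(Metric.ball_mem_nhds (x, x) hδ)] with p hp
  rw [Metric.mem_ball, Prod.dist_eq, max_lt_iff, dist_eq_norm, dist_eq_norm] at hp
  have h1 := h p.2 p.1 hp.2 hp.1
  have h2 := h p.1 p.2 hp.1 hp.2
  rw [← neg_sub p.1 p.2, map_neg, norm_neg] at h2
  exact abs_le.2 ⟨by linarith, h1⟩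

end LowerEnvelope

/-! ### Entropies and Csiszar divergences -/

theorem IsEntropy.le_of_one_le {φ : ℝ≥0 → ℝ≥0∞} (hφ : IsEntropy φ) {x y : ℝ≥0} (hx : 1 ≤ x)
    (hxy : x ≤ y) : φ x ≤ φ y := by
  rcases hxy.eq_or_lt with rfl | hlt
  · exact le_rfl
  have h1 : (1 : ℝ) ≤ x := by exact_mod_cast hx
  have h2 : (x : ℝ) < y := by exact_mod_cast hlt
  have h0 : (y : ℝ) - 1 ≠ 0 := by linarith
  obtain ⟨a, ha⟩ : ∃ a : ℝ≥0, (a : ℝ) = (y - x) / (y - 1) :=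
    ⟨⟨_, div_nonneg (by linarith) (by linarith)⟩, rfl⟩
  obtain ⟨b, hb'⟩ : ∃ b : ℝ≥0, (b : ℝ) = (x - 1) / (y - 1) :=
    ⟨⟨_, div_nonneg (by linarith) (by linarith)⟩, rfl⟩
  have hab : a + b = 1 := by
    apply NNReal.eq
    rw [NNReal.coe_add, ha, hb', NNReal.coe_one]
    field_simp
    ring
  have hx' : a • (1 : ℝ≥0) + b • y = x := by
    apply NNReal.eq
    rw [smul_eq_mul, smul_eq_mul, NNReal.coe_add, NNReal.coe_mul, NNReal.coe_mul, ha, hb',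
      NNReal.coe_one]
    field_simp
    ring
  have hb : b ≤ 1 := hab ▸ le_add_self
  calc φ x = φ (a • (1 : ℝ≥0) + b • y) := by rw [hx']
    _ ≤ a • φ 1 + b • φ y := hφ.convex.2 trivial trivial zero_le zero_le hab
    _ = b • φ y := by rw [hφ.map_one, smul_zero, zero_add]
    _ ≤ (1 : ℝ≥0) • φ y := by
        rw [ENNReal.smul_def, ENNReal.smul_def]
        gcongr
    _ = φ y := one_smul _ _

theorem klEntropy_eq (x : ℝ≥0) : klEntropy x = ENNReal.ofReal (InformationTheory.klFun x) := by
  rw [klEntropy, InformationTheory.klFun_apply]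
  congr 1
  ring

theorem klEntropy_one : klEntropy 1 = 0 := by
  rw [klEntropy_eq, NNReal.coe_one, InformationTheory.klFun_one, ENNReal.ofReal_zero]

theorem klEntropy_le_of_one_le {x y : ℝ≥0} (hx : 1 ≤ x) (hxy : x ≤ y) :
    klEntropy x ≤ klEntropy y := by
  rw [klEntropy_eq, klEntropy_eq]
  apply ENNReal.ofReal_le_ofReal
  have h := InformationTheory.convexOn_klFun.le_max_of_mem_Icc (x := 1) (y := (y : ℝ)) (z := (x : ℝ))
    (by simp) (by simp) ⟨by exact_mod_cast hx, by exact_mod_cast hxy⟩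
  rwa [InformationTheory.klFun_one, max_eq_right (InformationTheory.klFun_nonneg y.coe_nonneg)] at h

/-- On `[0, R]` the second derivative `1 / x` of `klFun` is at least `1 / R`. -/
theorem klFun_midpoint_le {R s t : ℝ} (hR : 0 < R) (hs : s ∈ Set.Icc 0 R) (ht : t ∈ Set.Icc 0 R) :
    InformationTheory.klFun ((s + t) / 2) + (s - t) ^ 2 / (8 * R)
      ≤ (InformationTheory.klFun s + InformationTheory.klFun t) / 2 := by
  have hder : ∀ x : ℝ, 0 < x → HasDerivAt (fun x => InformationTheory.klFun x - x ^ 2 / (2 * R))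
      (Real.log x - x / R) x := fun x hx => by
    have h1 := (InformationTheory.hasDerivAt_klFun hx.ne').sub
      ((hasDerivAt_pow 2 x).div_const (2 * R))
    refine h1.congr_deriv ?_
    field_simp
    norm_num
    ring
  have hconv : ConvexOn ℝ (Set.Icc 0 R) (fun x => InformationTheory.klFun x - x ^ 2 / (2 * R)) := by
    refine MonotoneOn.convexOn_of_deriv (convex_Icc 0 R) ?_ ?_ ?_
    · exact (InformationTheory.continuous_klFun.sub (by fun_prop)).continuousOn
    · rw [interior_Icc]
      exact fun x hx => (hder x hx.1).differentiableAt.differentiableWithinAt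
    · rw [interior_Icc]
      intro x hx y hy hxy
      rw [(hder x hx.1).deriv, (hder y hy.1).deriv]
      have hy0 : 0 < y := hy.1
      have h1 := Real.log_le_sub_one_of_pos (div_pos hx.1 hy.1)
      rw [Real.log_div hx.1.ne' hy.1.ne'] at h1
      have h2 : (y - x) / R ≤ (y - x) / y :=
        div_le_div_of_nonneg_left (by linarith) hy.1 hy.2.le
      have h3 : (y - x) / y = 1 - x / y := by field_simp
      rw [sub_div] at h2
      linarith
  have h := hconv.2 hs ht (show (0 : ℝ) ≤ 1 / 2 by norm_num)
    (show (0 : ℝ) ≤ 1 / 2 by norm_num) (by norm_num)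
  simp only [smul_eq_mul] at h
  rw [show 1 / 2 * s + 1 / 2 * t = (s + t) / 2 by ring] at h
  have h2 : ((s + t) / 2) ^ 2 / (2 * R) + (s - t) ^ 2 / (8 * R)
      = (s ^ 2 / (2 * R) + t ^ 2 / (2 * R)) / 2 := by
    field_simp
    ring
  linarith

section Csiszar

variable {ι : Type*} [Fintype ι] {φ : ℝ≥0 → ℝ≥0∞}

theorem csiszarDiv_of_ne_zero {y : ι → ℝ≥0} (hy : ∀ i, y i ≠ 0) (x : ι → ℝ≥0) :
    csiszarDiv φ x y = ∑ i, (y i : ℝ≥0∞) * φ (x i / y i) :=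
  Finset.sum_congr rfl fun i _ => if_neg (hy i)

theorem csiszarDiv_self (h1 : φ 1 = 0) {y : ι → ℝ≥0} (hy : ∀ i, y i ≠ 0) :
    csiszarDiv φ y y = 0 := by
  rw [csiszarDiv_of_ne_zero hy]
  refine Finset.sum_eq_zero fun i _ => ?_
  rw [div_self (hy i), h1, mul_zero]

/-- Lowering entries of `x` that exceed those of `y`, but not below `y`, lowers the divergence. -/
theorem csiszarDiv_le_of_lowering (hmono : ∀ s t : ℝ≥0, 1 ≤ s → s ≤ t → φ s ≤ φ t)
    {y x x' : ι → ℝ≥0} (hy : ∀ i, y i ≠ 0) (h : ∀ i, x i = x' i ∨ y i ≤ x i ∧ x i ≤ x' i) :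
    csiszarDiv φ x y ≤ csiszarDiv φ x' y := by
  rw [csiszarDiv_of_ne_zero hy, csiszarDiv_of_ne_zero hy]
  refine Finset.sum_le_sum fun i _ => ?_
  rcases h i with h | ⟨h1, h2⟩
  · rw [h]
  · refine mul_le_mul_right (hmono _ _ ?_ ?_) _
    · rwa [one_le_div₀ (pos_iff_ne_zero.2 (hy i))]
    · gcongr

theorem csiszarDiv_midpoint_le (hφ : ConvexOn ℝ≥0 Set.univ φ) {y : ι → ℝ≥0} (hy : ∀ i, y i ≠ 0)
    (x x' : ι → ℝ≥0) :
    csiszarDiv φ (fun i => 2⁻¹ * (x i + x' i)) y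
      ≤ 2⁻¹ * (csiszarDiv φ x y + csiszarDiv φ x' y) := by
  simp only [csiszarDiv_of_ne_zero hy]
  rw [← Finset.sum_add_distrib, Finset.mul_sum]
  refine Finset.sum_le_sum fun i _ => ?_
  have h := hφ.2 (x := x i / y i) (y := x' i / y i) trivial trivial
    (zero_le : 0 ≤ (2⁻¹ : ℝ≥0)) (zero_le : 0 ≤ (2⁻¹ : ℝ≥0)) (by
      apply NNReal.eq
      norm_num)
  have hsmul : ∀ z : ℝ≥0∞, (2⁻¹ : ℝ≥0) • z = 2⁻¹ * z := fun z => by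
    rw [ENNReal.smul_def, ENNReal.coe_inv two_ne_zero, ENNReal.coe_ofNat, smul_eq_mul]
  rw [hsmul, hsmul, smul_eq_mul, smul_eq_mul, ← mul_add, ← add_div, ← mul_add,
    ← mul_div_assoc] at h
  calc _ ≤ (y i : ℝ≥0∞) * (2⁻¹ * (φ (x i / y i) + φ (x' i / y i))) := by gcongr
    _ = _ := by ring

theorem klDiv_eq_ofReal {y : ι → ℝ≥0} (hy : ∀ i, y i ≠ 0) (x : ι → ℝ≥0) :
    klDiv x y = ENNReal.ofReal (∑ i, y i * InformationTheory.klFun (x i / y i)) := by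
  rw [klDiv, csiszarDiv_of_ne_zero hy, ENNReal.ofReal_sum_of_nonneg]
  · refine Finset.sum_congr rfl fun i _ => ?_
    rw [klEntropy_eq, NNReal.coe_div, ENNReal.ofReal_mul (y i).coe_nonneg,
      ENNReal.ofReal_coe_nnreal]
  · exact fun i _ => mul_nonneg (y i).coe_nonneg (InformationTheory.klFun_nonneg (by positivity))

end Csiszar

/-! ### The transport cost as a lower envelope -/

section Transport

variable {m : ℕ} {φ : ℝ≥0 → ℝ≥0∞} {τ ε : ℝ≥0}

/-- The Kullback-Leibler divergence of a plan from the product of the uniform weights. -/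
noncomputable def planKL (p : Fin m → Fin m → ℝ≥0) : ℝ≥0∞ :=
  klDiv (fun q : Fin m × Fin m => p q.1 q.2) (fun q => uniformVec m q.1 * uniformVec m q.2)

/-- The part of the energy of a plan that does not depend on the cost matrix, for uniform weights. -/
noncomputable def planPenalty (φ : ℝ≥0 → ℝ≥0∞) (τ ε : ℝ≥0) (p : Fin m → Fin m → ℝ≥0) :
    ℝ≥0∞ :=
  (τ : ℝ≥0∞) * csiszarDiv φ (fun i => ∑ j, p i j) (uniformVec m)
    + (τ : ℝ≥0∞) * csiszarDiv φ (fun j => ∑ i, p i j) (uniformVec m)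
    + (ε : ℝ≥0∞) * planKL p

/-- The linear functional `C ↦ ⟨C, Π⟩` of a plan `Π`. -/
noncomputable def planPairing (p : Fin m → Fin m → ℝ≥0) :
    (Fin m → Fin m → ℝ) →L[ℝ] ℝ :=
  ∑ i, ∑ j, (p i j : ℝ) •
    (ContinuousLinearMap.proj (R := ℝ) (φ := fun _ : Fin m => ℝ) j).comp
      (ContinuousLinearMap.proj (R := ℝ) (φ := fun _ : Fin m => Fin m → ℝ) i)

/-- The affine functions `C ↦ ⟨C, Π⟩ + r` given by the plans of finite penalty `r` whose entries are
at most `1 / m`. -/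
def planFamily (m : ℕ) (φ : ℝ≥0 → ℝ≥0∞) (τ ε : ℝ≥0) :
    Set (((Fin m → Fin m → ℝ) →L[ℝ] ℝ) × ℝ) :=
  {s | ∃ p : Fin m → Fin m → ℝ≥0, (∀ i j, p i j ≤ (m : ℝ≥0)⁻¹) ∧
    planPenalty φ τ ε p ≠ ⊤ ∧ s = (planPairing p, (planPenalty φ τ ε p).toReal)}

theorem planPairing_apply (p : Fin m → Fin m → ℝ≥0) (C : Fin m → Fin m → ℝ) :
    planPairing p C = ∑ i, ∑ j, C i j * (p i j : ℝ) := by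
  simp [planPairing, mul_comm]

theorem uotEnergy_uniform (p : Fin m → Fin m → ℝ≥0) (C : Fin m → Fin m → ℝ) :
    uotEnergy φ τ ε (uniformVec m) (uniformVec m) (Matrix.of C) (Matrix.of p)
      = (planPairing p C : ℝ) + (planPenalty φ τ ε p : ℝ≥0∞) := by
  rw [planPairing_apply]
  rfl

theorem norm_planPairing_sub_le (p p' : Fin m → Fin m → ℝ≥0) :
    ‖planPairing p - planPairing p'‖ ≤ ∑ q : Fin m × Fin m, |(p q.1 q.2 : ℝ) - p' q.1 q.2| := by
  refine ContinuousLinearMap.opNorm_le_bound _ (Finset.sum_nonneg fun _ _ => abs_nonneg _)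
    fun C => ?_
  rw [sub_apply, planPairing_apply, planPairing_apply, ← Finset.sum_sub_distrib, Finset.sum_mul,
    Fintype.sum_prod_type]
  refine (Finset.abs_sum_le_sum_abs _ _).trans (Finset.sum_le_sum fun i _ => ?_)
  rw [← Finset.sum_sub_distrib]
  refine (Finset.abs_sum_le_sum_abs _ _).trans (Finset.sum_le_sum fun j _ => ?_)
  rw [← mul_sub, abs_mul, mul_comm]
  gcongr
  exact (norm_le_pi_norm (C i) j).trans (norm_le_pi_norm C i)

theorem norm_planPairing_le (hm : 0 < m) {p : Fin m → Fin m → ℝ≥0}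
    (hp : ∀ i j, p i j ≤ (m : ℝ≥0)⁻¹) : ‖planPairing p‖ ≤ m := by
  have h0 : planPairing (fun _ _ => 0 : Fin m → Fin m → ℝ≥0) = 0 := by
    ext C
    simp [planPairing_apply]
  have h := norm_planPairing_sub_le p (fun _ _ => 0)
  rw [h0, sub_zero] at h
  refine h.trans ?_
  have h1 : ∀ q ∈ (Finset.univ : Finset (Fin m × Fin m)),
      |(p q.1 q.2 : ℝ) - (0 : ℝ≥0)| ≤ (m : ℝ)⁻¹ := fun q _ => by
    have : (p q.1 q.2 : ℝ) ≤ (m : ℝ)⁻¹ := by exact_mod_cast hp q.1 q.2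
    simpa using this
  refine (Finset.sum_le_card_nsmul _ _ _ h1).trans (le_of_eq ?_)
  have : (m : ℝ) ≠ 0 := by positivity
  simp [this]

theorem uniformVec_ne_zero (hm : 0 < m) (i : Fin m) : uniformVec m i ≠ 0 := by
  have : (m : ℝ≥0) ≠ 0 := by positivity
  exact inv_ne_zero this

theorem uniformVec_mul_ne_zero (hm : 0 < m) (q : Fin m × Fin m) :
    uniformVec m q.1 * uniformVec m q.2 ≠ 0 :=
  mul_ne_zero (uniformVec_ne_zero hm _) (uniformVec_ne_zero hm _)

theorem isBoundedFamily_planFamily (hm : 0 < m) (hφ : IsEntropy φ) :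
    IsBoundedFamily (planFamily m φ τ ε) m where
  nonempty := by
    have hm0 : (m : ℝ≥0) ≠ 0 := by positivity
    have hm1 : (m : ℝ≥0)⁻¹ ≤ 1 := inv_le_one_of_one_le₀ (by exact_mod_cast hm)
    refine ⟨(_, _), fun i j => uniformVec m i * uniformVec m j, fun i j => ?_, ?_, rfl⟩
    · exact mul_le_of_le_one_left zero_le hm1
    · have h1 : (fun i => ∑ j, uniformVec m i * uniformVec m j) = uniformVec m := by
        funext i
        simp [uniformVec, hm0]
      have h2 : (fun j => ∑ i, uniformVec m i * uniformVec m j) = uniformVec m := by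
        funext i
        simp [uniformVec, hm0]
      have h3 : planKL (fun i j => uniformVec m i * uniformVec m j) = 0 :=
        csiszarDiv_self klEntropy_one (uniformVec_mul_ne_zero hm)
      simp only [planPenalty, h1, h2, h3, csiszarDiv_self hφ.map_one (uniformVec_ne_zero hm),
        mul_zero, add_zero]
      exact ENNReal.zero_ne_top
  norm_le := by
    rintro _ ⟨p, hp, -, rfl⟩
    exact norm_planPairing_le hm hp
  nonneg := by
    rintro _ ⟨p, hp, -, rfl⟩
    exact ENNReal.toReal_nonneg

/-- Truncating the entries of a plan at `1 / m` does not increase the penalty: a marginal that is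
changed stays at least `1 / m`, and entropies increase on `[1, ∞)`. -/
theorem planPenalty_truncate_le (hm : 0 < m) (hφ : IsEntropy φ)
    (p : Fin m → Fin m → ℝ≥0) :
    planPenalty φ τ ε (fun i j => min (p i j) (m : ℝ≥0)⁻¹) ≤ planPenalty φ τ ε p := by
  have hsum : ∀ a : Fin m → ℝ≥0, ∑ j, min (a j) (m : ℝ≥0)⁻¹ = ∑ j, a j ∨
      (m : ℝ≥0)⁻¹ ≤ ∑ j, min (a j) (m : ℝ≥0)⁻¹ ∧ ∑ j, min (a j) (m : ℝ≥0)⁻¹ ≤ ∑ j, a j :=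
    fun a => by
    by_cases h : ∀ j, a j ≤ (m : ℝ≥0)⁻¹
    · exact .inl (Finset.sum_congr rfl fun j _ => min_eq_left (h j))
    · push Not at h
      obtain ⟨j, hj⟩ := h
      refine .inr ⟨?_, Finset.sum_le_sum fun j _ => min_le_left _ _⟩
      calc (m : ℝ≥0)⁻¹ = min (a j) (m : ℝ≥0)⁻¹ := (min_eq_right hj.le).symm
        _ ≤ _ := Finset.single_le_sum (f := fun j => min (a j) (m : ℝ≥0)⁻¹)
          (fun _ _ => zero_le) (Finset.mem_univ j)
  have hmono : ∀ s t : ℝ≥0, 1 ≤ s → s ≤ t → φ s ≤ φ t := fun s t => hφ.le_of_one_le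
  refine add_le_add (add_le_add (mul_le_mul_right ?_ _) (mul_le_mul_right ?_ _))
    (mul_le_mul_right ?_ _)
  · exact csiszarDiv_le_of_lowering hmono (uniformVec_ne_zero hm) fun i => hsum (fun j => p i j)
  · exact csiszarDiv_le_of_lowering hmono (uniformVec_ne_zero hm) fun j => hsum (fun i => p i j)
  · refine csiszarDiv_le_of_lowering (fun s t => klEntropy_le_of_one_le)
      (uniformVec_mul_ne_zero hm) fun q => ?_
    rcases le_total (p q.1 q.2) (m : ℝ≥0)⁻¹ with h | h
    · exact .inl (min_eq_left h)
    · refine .inr ⟨?_, min_le_left _ _⟩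
      simp only [min_eq_right h]
      exact mul_le_of_le_one_left zero_le (inv_le_one_of_one_le₀ (by exact_mod_cast hm))

/-- For a nonnegative cost matrix only plans with entries at most `1 / m` matter. -/
theorem uot_eq_lowerEnvelope (hm : 0 < m) (hφ : IsEntropy φ) {C : Fin m → Fin m → ℝ}
    (hC : ∀ i j, 0 ≤ C i j) :
    uot φ τ ε (uniformVec m) (uniformVec m) (Matrix.of C)
      = (lowerEnvelope (planFamily m φ τ ε) C : ℝ) := by
  have hS := isBoundedFamily_planFamily (τ := τ) (ε := ε) hm hφ
  apply le_antisymm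
  · refine EReal.le_of_forall_lt_iff_le.1 fun r hr => ?_
    obtain ⟨_, ⟨p, hp, hfin, rfl⟩, h⟩ := hS.exists_lt C (sub_pos.2 (EReal.coe_lt_coe_iff.1 hr))
    refine (iInf_le _ (Matrix.of p)).trans ?_
    rw [uotEnergy_uniform, ← ENNReal.ofReal_toReal hfin, EReal.coe_ennreal_ofReal,
      max_eq_left ENNReal.toReal_nonneg, ← EReal.coe_add, EReal.coe_le_coe_iff]
    rw [add_sub_cancel] at h
    exact h.le
  · refine le_iInf fun p => ?_
    obtain ⟨p, rfl⟩ := Matrix.of.surjective p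
    rw [uotEnergy_uniform]
    by_cases hfin : planPenalty φ τ ε p = ⊤
    · rw [hfin, EReal.coe_ennreal_top, EReal.coe_add_top]
      exact le_top
    have htr := planPenalty_truncate_le (τ := τ) (ε := ε) hm hφ p
    have h1 := hS.lowerEnvelope_le C
      ⟨_, fun i j => min_le_right _ _, ne_top_of_le_ne_top hfin htr, rfl⟩
    rw [← ENNReal.ofReal_toReal hfin, EReal.coe_ennreal_ofReal,
      max_eq_left ENNReal.toReal_nonneg, ← EReal.coe_add, EReal.coe_le_coe_iff]
    refine h1.trans (add_le_add ?_ (ENNReal.toReal_mono hfin htr))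
    simp only
    rw [planPairing_apply, planPairing_apply]
    refine Finset.sum_le_sum fun i _ => Finset.sum_le_sum fun j _ => ?_
    exact mul_le_mul_of_nonneg_left (by exact_mod_cast min_le_left _ _) (hC i j)

/-- Without regularization and with a vanishing diagonal, the diagonal plan has energy zero. -/
theorem lowerEnvelope_eq_zero_of_diag (hm : 0 < m) (hφ : IsEntropy φ)
    {C : Fin m → Fin m → ℝ} (hC : ∀ i j, 0 ≤ C i j) (hdiag : ∀ i, C i i = 0) :
    lowerEnvelope (planFamily m φ τ 0) C = 0 := by
  have hS := isBoundedFamily_planFamily (τ := τ) (ε := 0) hm hφ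
  apply le_antisymm
  · let p : Fin m → Fin m → ℝ≥0 := fun i j => if i = j then (m : ℝ≥0)⁻¹ else 0
    have hpen : planPenalty φ τ 0 p = 0 := by
      have h1 : (fun i => ∑ j, p i j) = uniformVec m := by
        funext i
        simp [p, uniformVec]
      have h2 : (fun j => ∑ i, p i j) = uniformVec m := by
        funext i
        simp [p, uniformVec]
      rw [planPenalty, h1, h2, csiszarDiv_self hφ.map_one (uniformVec_ne_zero hm)]
      simp
    have h := hS.lowerEnvelope_le C ⟨p, fun i j => ?_, by simp [hpen], rfl⟩
    · simp only at h
      rw [hpen, planPairing_apply] at h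
      refine h.trans (le_of_eq ?_)
      rw [ENNReal.toReal_zero, add_zero]
      refine Finset.sum_eq_zero fun i _ => Finset.sum_eq_zero fun j _ => ?_
      by_cases hij : i = j <;> simp [p, hij, hdiag]
    · by_cases hij : i = j <;> simp [p, hij]
  · refine hS.le_lowerEnvelope ?_
    rintro _ ⟨p, -, -, rfl⟩
    simp only
    rw [planPairing_apply]
    exact add_nonneg (Finset.sum_nonneg fun i _ => Finset.sum_nonneg fun j _ =>
      mul_nonneg (hC i j) (p i j).coe_nonneg) ENNReal.toReal_nonneg

theorem planPairing_midpoint (p p' : Fin m → Fin m → ℝ≥0) :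
    planPairing (fun i j => 2⁻¹ * (p i j + p' i j))
      = (1 / 2 : ℝ) • (planPairing p + planPairing p') := by
  refine ContinuousLinearMap.ext fun C => ?_
  simp only [planPairing_apply, smul_apply, add_apply, smul_eq_mul,
    ← Finset.sum_add_distrib, Finset.mul_sum]
  refine Finset.sum_congr rfl fun i _ => Finset.sum_congr rfl fun j _ => ?_
  push_cast
  ring

theorem klDiv_midpoint_le (hm : 0 < m) {p p' : Fin m → Fin m → ℝ≥0}
    (hp : ∀ i j, p i j ≤ (m : ℝ≥0)⁻¹) (hp' : ∀ i j, p' i j ≤ (m : ℝ≥0)⁻¹) :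
    (planKL (fun i j => 2⁻¹ * (p i j + p' i j))).toReal
        + (m : ℝ) / 8 * ∑ q : Fin m × Fin m, |(p q.1 q.2 : ℝ) - p' q.1 q.2| ^ 2
      ≤ ((planKL p).toReal + (planKL p').toReal) / 2 := by
  have hm0 : (0 : ℝ) < m := by exact_mod_cast hm
  have hK : ∀ p : Fin m → Fin m → ℝ≥0, (planKL p).toReal = ∑ q : Fin m × Fin m,
      ((m : ℝ)⁻¹ * (m : ℝ)⁻¹) * InformationTheory.klFun (p q.1 q.2 * (m * m)) := fun p => by
    rw [planKL, klDiv_eq_ofReal (uniformVec_mul_ne_zero hm), ENNReal.toReal_ofReal]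
    · refine Finset.sum_congr rfl fun q _ => ?_
      simp only [uniformVec, NNReal.coe_mul, NNReal.coe_inv, NNReal.coe_natCast, div_eq_mul_inv,
        mul_inv, inv_inv]
    · exact Finset.sum_nonneg fun q _ => mul_nonneg (NNReal.coe_nonneg _)
        (InformationTheory.klFun_nonneg (by positivity))
  rw [hK, hK, hK, ← Finset.sum_add_distrib, Finset.sum_div, Finset.mul_sum,
    ← Finset.sum_add_distrib]
  refine Finset.sum_le_sum fun q _ => ?_
  have hmem : ∀ x : ℝ≥0, x ≤ (m : ℝ≥0)⁻¹ → (x : ℝ) * (m * m) ∈ Set.Icc (0 : ℝ) m := fun x hx => by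
    have hx' : (x : ℝ) ≤ (m : ℝ)⁻¹ := by exact_mod_cast hx
    refine ⟨by positivity, ?_⟩
    calc (x : ℝ) * (m * m) ≤ (m : ℝ)⁻¹ * (m * m) := by gcongr
      _ = m := by field_simp
  have h := mul_le_mul_of_nonneg_left
    (klFun_midpoint_le hm0 (hmem _ (hp q.1 q.2)) (hmem _ (hp' q.1 q.2)))
    (show 0 ≤ (m : ℝ)⁻¹ * (m : ℝ)⁻¹ by positivity)
  have h1 : (((2⁻¹ * (p q.1 q.2 + p' q.1 q.2) : ℝ≥0) : ℝ)) * (m * m)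
      = ((p q.1 q.2 : ℝ) * (m * m) + p' q.1 q.2 * (m * m)) / 2 := by
    push_cast
    ring
  have h2 : (m : ℝ) / 8 * |(p q.1 q.2 : ℝ) - p' q.1 q.2| ^ 2 = (m : ℝ)⁻¹ * (m : ℝ)⁻¹ *
      (((p q.1 q.2 : ℝ) * (m * m) - p' q.1 q.2 * (m * m)) ^ 2 / (8 * m)) := by
    rw [sq_abs]
    field_simp
  rw [h1, h2]
  linarith

/-- The entropic regularization makes the family of plans uniformly midpoint-convex. -/
theorem planFamily_midpoint (hm : 0 < m) (hφ : IsEntropy φ) :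
    ∀ s ∈ planFamily m φ τ ε, ∀ t ∈ planFamily m φ τ ε,
      ∃ r, ((1 / 2 : ℝ) • (s.1 + t.1), r) ∈ planFamily m φ τ ε ∧
        r + (ε / (8 * m) : ℝ) * ‖s.1 - t.1‖ ^ 2 ≤ (s.2 + t.2) / 2 := by
  rintro _ ⟨p, hp, hfin, rfl⟩ _ ⟨p', hp', hfin', rfl⟩
  have hm0 : (0 : ℝ) < m := by exact_mod_cast hm
  let A : (Fin m → Fin m → ℝ≥0) → ℝ≥0∞ := fun p =>
    (τ : ℝ≥0∞) * csiszarDiv φ (fun i => ∑ j, p i j) (uniformVec m)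
      + (τ : ℝ≥0∞) * csiszarDiv φ (fun j => ∑ i, p i j) (uniformVec m)
  let mid : Fin m → Fin m → ℝ≥0 := fun i j => 2⁻¹ * (p i j + p' i j)
  have hpen : ∀ p, planPenalty φ τ ε p = A p + ε * planKL p := fun p => rfl
  have hKfin : ∀ p, (ε : ℝ≥0∞) * planKL p ≠ ⊤ := fun p => by
    refine ENNReal.mul_ne_top ENNReal.coe_ne_top ?_
    rw [planKL, klDiv_eq_ofReal (uniformVec_mul_ne_zero hm)]
    exact ENNReal.ofReal_ne_top
  have hAfin : A p ≠ ⊤ := ne_top_of_le_ne_top hfin le_self_add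
  have hAfin' : A p' ≠ ⊤ := ne_top_of_le_ne_top hfin' le_self_add
  have hA : A mid ≤ 2⁻¹ * (A p + A p') := by
    have h1 := csiszarDiv_midpoint_le hφ.convex (uniformVec_ne_zero hm) (fun i => ∑ j, p i j)
      (fun i => ∑ j, p' i j)
    have h2 := csiszarDiv_midpoint_le hφ.convex (uniformVec_ne_zero hm) (fun j => ∑ i, p i j)
      (fun j => ∑ i, p' i j)
    simp only [← Finset.sum_add_distrib, Finset.mul_sum] at h1 h2
    calc A mid ≤ (τ : ℝ≥0∞) * _ + τ * _ := add_le_add (mul_le_mul_right h1 _) (mul_le_mul_right h2 _)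
      _ = _ := by
        simp only [A]
        ring
  have hAsum : 2⁻¹ * (A p + A p') ≠ ⊤ :=
    ENNReal.mul_ne_top (by simp) (ENNReal.add_ne_top.2 ⟨hAfin, hAfin'⟩)
  have hAmid : A mid ≠ ⊤ := ne_top_of_le_ne_top hAsum hA
  have hAreal : (A mid).toReal ≤ ((A p).toReal + (A p').toReal) / 2 := by
    have := ENNReal.toReal_mono hAsum hA
    rw [ENNReal.toReal_mul, ENNReal.toReal_add hAfin hAfin', ENNReal.toReal_inv,
      ENNReal.toReal_ofNat] at this
    linarith
  have hreal : ∀ p, A p ≠ ⊤ → (planPenalty φ τ ε p).toReal = (A p).toReal + ε * (planKL p).toReal :=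
    fun p h => by
    rw [hpen, ENNReal.toReal_add h (hKfin p), ENNReal.toReal_mul, ENNReal.coe_toReal]
  refine ⟨(planPenalty φ τ ε mid).toReal, ⟨mid, fun i j => ?_, ?_, ?_⟩, ?_⟩
  · calc mid i j ≤ 2⁻¹ * ((m : ℝ≥0)⁻¹ + (m : ℝ≥0)⁻¹) := by
          simp only [mid]
          gcongr
          exacts [hp i j, hp' i j]
      _ = (m : ℝ≥0)⁻¹ := by
          rw [← two_mul, inv_mul_cancel_left₀ two_ne_zero]
  · rw [hpen]
    exact ENNReal.add_ne_top.2 ⟨hAmid, hKfin mid⟩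
  · rw [planPairing_midpoint]
  · simp only
    rw [hreal mid hAmid, hreal p hAfin, hreal p' hAfin']
    have h1 := mul_le_mul_of_nonneg_left (klDiv_midpoint_le hm hp hp') ε.coe_nonneg
    have h2 : ‖planPairing p - planPairing p'‖ ^ 2
        ≤ (m * m) * ∑ q : Fin m × Fin m, |(p q.1 q.2 : ℝ) - p' q.1 q.2| ^ 2 := by
      refine (pow_le_pow_left₀ (norm_nonneg _) (norm_planPairing_sub_le p p') 2).trans ?_
      refine sq_sum_le_card_mul_sum_sq.trans (le_of_eq ?_)
      simp
    have h3 := mul_le_mul_of_nonneg_left h2 (show (0 : ℝ) ≤ ε / (8 * m) by positivity)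
    have h4 : (ε / (8 * m) : ℝ) * ((m * m) * ∑ q : Fin m × Fin m,
          |(p q.1 q.2 : ℝ) - p' q.1 q.2| ^ 2)
        = ε * ((m : ℝ) / 8 * ∑ q : Fin m × Fin m, |(p q.1 q.2 : ℝ) - p' q.1 q.2| ^ 2) := by
      field_simp
    rw [mul_add, mul_div_assoc', mul_add] at h1
    change _ * (planKL mid).toReal + _ ≤ _ at h1
    linarith

/-- With entropic regularization the transport cost is strictly differentiable in the cost matrix. -/
theorem exists_hasStrictFDerivAt_lowerEnvelope (hm : 0 < m) (hφ : IsEntropy φ) (hε : 0 < ε)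
    (C : Fin m → Fin m → ℝ) :
    ∃ g : (Fin m → Fin m → ℝ) →L[ℝ] ℝ,
      HasStrictFDerivAt (lowerEnvelope (planFamily m φ τ ε)) g C :=
  (isBoundedFamily_planFamily hm hφ).exists_hasStrictFDerivAt
    (κ := ε / (8 * m)) (by positivity) (planFamily_midpoint hm hφ) C

end Transport

/-! ### Integrable selections of random subdifferentials -/

section Selection

variable {Ω E : Type*} [MeasurableSpace Ω] {P : Measure Ω} [NormedAddCommGroup E]
  [InnerProductSpace ℝ E]

/-- A sublinear function on `E` bounded by `k * ‖·‖`. -/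
structure IsBoundedSublinear (σ : E → ℝ) (k : ℝ) : Prop where
  smul_eq : ∀ a : ℝ, 0 < a → ∀ v, σ (a • v) = a * σ v
  add_le : ∀ v w, σ (v + w) ≤ σ v + σ w
  abs_le : ∀ v, |σ v| ≤ k * ‖v‖

theorem IsBoundedSublinear.map_zero {σ : E → ℝ} {k : ℝ} (h : IsBoundedSublinear σ k) :
    σ 0 = 0 := by
  simpa using h.abs_le 0

theorem IsBoundedSublinear.comp_neg {σ : E → ℝ} {k : ℝ} (h : IsBoundedSublinear σ k) :
    IsBoundedSublinear (fun v => σ (-v)) k where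
  smul_eq a ha v := by rw [← smul_neg, h.smul_eq a ha]
  add_le v w := by
    rw [neg_add]
    exact h.add_le _ _
  abs_le v := by
    rw [← norm_neg v]
    exact h.abs_le _

theorem IsBoundedSublinear.abs_sub_le {σ : E → ℝ} {k : ℝ} (h : IsBoundedSublinear σ k) (v w : E) :
    |σ v - σ w| ≤ k * ‖v - w‖ := by
  have key : ∀ v w, σ v - σ w ≤ k * ‖v - w‖ := fun v w => by
    have h1 := h.add_le w (v - w)
    rw [add_sub_cancel] at h1
    have h2 := (_root_.abs_le.1 (h.abs_le (v - w))).2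
    linarith
  refine _root_.abs_le.2 ⟨?_, key v w⟩
  have := key w v
  rw [norm_sub_rev] at this
  linarith

theorem IsBoundedSublinear.continuous {σ : E → ℝ} {k : ℝ} (h : IsBoundedSublinear σ k) :
    Continuous σ := by
  refine (LipschitzWith.of_dist_le_mul (K := k.toNNReal) fun x y => ?_).continuous
  rw [Real.dist_eq, dist_eq_norm]
  exact (h.abs_sub_le x y).trans
    (mul_le_mul_of_nonneg_right (Real.le_coe_toNNReal k) (norm_nonneg _))

/-- A random sublinear function with bound `k`, measurable in each direction. -/
structure IsRandomSublinear (P : Measure Ω) (σ : Ω → E → ℝ) (k : Ω → ℝ) : Prop where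
  aestronglyMeasurable : ∀ v, AEStronglyMeasurable (fun ω => σ ω v) P
  sublinear : ∀ᵐ ω ∂P, IsBoundedSublinear (σ ω) (k ω)

/-- Continuity in the direction allows random directions: approximate them by simple functions. -/
theorem IsRandomSublinear.aestronglyMeasurable_comp {σ : Ω → E → ℝ} {k : Ω → ℝ}
    (h : IsRandomSublinear P σ k) {w : Ω → E} (hw : AEStronglyMeasurable w P) :
    AEStronglyMeasurable (fun ω => σ ω (w ω)) P := by
  have hsimple : ∀ f : SimpleFunc Ω E, AEStronglyMeasurable (fun ω => σ ω (f ω)) P := fun f => by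
    have h1 : (fun ω => σ ω (f ω))
        = fun ω => ∑ y ∈ f.range, (f ⁻¹' {y}).indicator (fun ω => σ ω y) ω := by
      funext ω
      rw [Finset.sum_eq_single (f ω)]
      · rw [Set.indicator_of_mem (by simp)]
      · intro y _ hy
        exact Set.indicator_of_notMem (fun hmem => hy (by simpa using hmem.symm)) _
      · exact fun hmem => absurd (SimpleFunc.mem_range_self f ω) hmem
    rw [h1]
    exact Finset.aestronglyMeasurable_fun_sum _ fun y _ =>
      (h.aestronglyMeasurable y).indicator (f.measurableSet_preimage _)
  refine aestronglyMeasurable_of_tendsto_ae atTop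
    (fun n => hsimple (hw.stronglyMeasurable_mk.approx n)) ?_
  filter_upwards [h.sublinear, hw.ae_eq_mk] with ω hω hmk
  rw [hmk]
  exact (hω.continuous.tendsto _).comp (hw.stronglyMeasurable_mk.tendsto_approx ω)

theorem IsRandomSublinear.integrable {σ : Ω → E → ℝ} {k : Ω → ℝ}
    (h : IsRandomSublinear P σ k) (hk : Integrable k P) (v : E) :
    Integrable (fun ω => σ ω v) P := by
  refine (hk.mul_const ‖v‖).mono' (h.aestronglyMeasurable v) ?_
  filter_upwards [h.sublinear] with ω hω
  exact hω.abs_le v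

theorem IsRandomSublinear.isBoundedSublinear_integral {σ : Ω → E → ℝ} {k : Ω → ℝ}
    (h : IsRandomSublinear P σ k) (hk : Integrable k P) :
    IsBoundedSublinear (fun v => ∫ ω, σ ω v ∂P) (∫ ω, k ω ∂P) where
  smul_eq a ha v := by
    rw [← integral_const_mul]
    refine integral_congr_ae ?_
    filter_upwards [h.sublinear] with ω hω
    exact hω.smul_eq a ha v
  add_le v w := by
    rw [← integral_add (h.integrable hk v) (h.integrable hk w)]
    refine integral_mono_ae (h.integrable hk _) ((h.integrable hk v).add (h.integrable hk w)) ?_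
    filter_upwards [h.sublinear] with ω hω
    exact hω.add_le v w
  abs_le v := by
    rw [← integral_mul_const, ← Real.norm_eq_abs]
    refine norm_integral_le_of_norm_le (hk.mul_const _) ?_
    filter_upwards [h.sublinear] with ω hω
    exact hω.abs_le v

/-- A vector below the expectation of a random sublinear function is the expectation of an integrable
random vector that lies below almost surely.

With `r = √(k + 1)`, the functional `w ↦ E[σ(w / r)]` on `L²(P; E)` is sublinear and bounded, and
`r v ↦ ⟨z, v⟩` is a linear functional below it on a subspace.  A Hahn-Banach extension is bounded, hence
the inner product with some `η ∈ L²`; the selection is `r η`, as the test functions `1_A r v` show. -/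
theorem IsRandomSublinear.exists_selection [IsProbabilityMeasure P] [CompleteSpace E]
    [TopologicalSpace.SeparableSpace E] {σ : Ω → E → ℝ} {k : Ω → ℝ}
    (h : IsRandomSublinear P σ k) (hk : Integrable k P) (hk0 : ∀ ω, 0 ≤ k ω) {z : E}
    (hz : ∀ v : E, inner ℝ z v ≤ ∫ ω, σ ω v ∂P) :
    ∃ ξ : Ω → E, Integrable ξ P ∧ (∀ᵐ ω ∂P, ∀ v : E, inner ℝ (ξ ω) v ≤ σ ω v) ∧ ∫ ω, ξ ω ∂P = z := by
  let r : Ω → ℝ := fun ω => √(k ω + 1)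
  have hr0 : ∀ ω, 0 < r ω := fun ω => Real.sqrt_pos.2 (by linarith [hk0 ω])
  have hrsq : ∀ ω, r ω ^ 2 = k ω + 1 := fun ω => Real.sq_sqrt (by linarith [hk0 ω])
  have hrm : AEStronglyMeasurable r P :=
    Real.continuous_sqrt.comp_aestronglyMeasurable (hk.1.add aestronglyMeasurable_const)
  have hr : MemLp r 2 P := by
    rw [memLp_two_iff_integrable_sq hrm]
    simp only [hrsq]
    exact hk.add (integrable_const 1)
  have hdom : ∀ w : Lp E 2 P, Integrable (fun ω => r ω * ‖w ω‖) P := fun w =>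
    hr.integrable_mul (Lp.memLp w).norm
  have hbound : ∀ w : Lp E 2 P, ∀ᵐ ω ∂P, ‖σ ω ((r ω)⁻¹ • w ω)‖ ≤ r ω * ‖w ω‖ := fun w => by
    filter_upwards [h.sublinear] with ω hω
    refine (hω.abs_le _).trans ?_
    rw [norm_smul, norm_inv, Real.norm_of_nonneg (hr0 ω).le, ← mul_assoc]
    refine mul_le_mul_of_nonneg_right ?_ (norm_nonneg _)
    rw [← div_eq_mul_inv, div_le_iff₀ (hr0 ω), ← sq, hrsq]
    linarith
  have hSint : ∀ w : Lp E 2 P, Integrable (fun ω => σ ω ((r ω)⁻¹ • w ω)) P := fun w =>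
    (hdom w).mono' (h.aestronglyMeasurable_comp
      (hrm.aemeasurable.inv.aestronglyMeasurable.smul (Lp.aestronglyMeasurable w))) (hbound w)
  let S : Lp E 2 P → ℝ := fun w => ∫ ω, σ ω ((r ω)⁻¹ • w ω) ∂P
  have hS_le : ∀ w, S w ≤ ‖hr.toLp r‖ * ‖w‖ := fun w => by
    have hw : MemLp (fun ω => ‖w ω‖) 2 P := (Lp.memLp w).norm
    have h1 : ‖hw.toLp _‖ = ‖w‖ := by
      rw [Lp.norm_toLp, eLpNorm_norm, Lp.norm_def]
    rw [← h1]
    refine le_trans ?_ (real_inner_le_norm (hr.toLp r) (hw.toLp _))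
    rw [L2.inner_def]
    refine integral_mono_ae (hSint w) (L2.integrable_inner _ _) ?_
    filter_upwards [hbound w, hr.coeFn_toLp, hw.coeFn_toLp] with ω hω h2 h3
    rw [h2, h3]
    refine (le_abs_self _).trans (hω.trans (le_of_eq ?_))
    simp [mul_comm]
  have hmem : ∀ v : E, MemLp (fun ω => r ω • v) 2 P := fun v =>
    hr.of_le_mul (c := ‖v‖) (hrm.smul_const v) (.of_forall fun ω => by
      rw [norm_smul, mul_comm])
  let T : E →ₗ[ℝ] Lp E 2 P :=
    { toFun := fun v => (hmem v).toLp _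
      map_add' := fun v w => by
        rw [← MemLp.toLp_add]
        exact MemLp.toLp_congr _ _ (.of_forall fun ω => smul_add _ _ _)
      map_smul' := fun a v => by
        rw [RingHom.id_apply, ← MemLp.toLp_const_smul]
        exact MemLp.toLp_congr _ _ (.of_forall fun ω => smul_comm _ _ _) }
  have hTcoe : ∀ v, (T v : Ω → E) =ᵐ[P] fun ω => r ω • v := fun v => (hmem v).coeFn_toLp
  have hTinj : Function.Injective T := by
    refine (injective_iff_map_eq_zero T).2 fun v hv => ?_
    have h1 := hTcoe v
    rw [hv] at h1
    obtain ⟨ω, h2, h3⟩ := (h1.and (Lp.coeFn_zero E 2 P)).exists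
    rw [h3] at h2
    exact (smul_eq_zero.1 h2.symm).resolve_left (hr0 ω).ne'
  have hST : ∀ v, S (T v) = ∫ ω, σ ω v ∂P := fun v => by
    refine integral_congr_ae ?_
    filter_upwards [hTcoe v] with ω hω
    rw [hω, inv_smul_smul₀ (hr0 ω).ne']
  let f : Lp E 2 P →ₗ.[ℝ] ℝ :=
    ⟨LinearMap.range T, (innerₗ E z).comp (LinearEquiv.ofInjective T hTinj).symm.toLinearMap⟩
  have hf : ∀ v, f ⟨T v, LinearMap.mem_range_self T v⟩ = inner ℝ z v := fun v => by
    have : (LinearEquiv.ofInjective T hTinj).symm ⟨T v, LinearMap.mem_range_self T v⟩ = v :=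
      (LinearEquiv.symm_apply_eq _).2 rfl
    change inner ℝ z ((LinearEquiv.ofInjective T hTinj).symm ⟨T v, _⟩) = _
    rw [this]
  obtain ⟨g, hgf, hgS⟩ := exists_extension_of_le_sublinear f S
    (fun a ha w => by
      rw [← integral_const_mul]
      refine integral_congr_ae ?_
      filter_upwards [h.sublinear, Lp.coeFn_smul a w] with ω hω h1
      rw [h1, Pi.smul_apply, smul_comm, hω.smul_eq a ha])
    (fun w w' => by
      rw [← integral_add (hSint w) (hSint w')]
      refine integral_mono_ae (hSint _) ((hSint w).add (hSint w')) ?_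
      filter_upwards [h.sublinear, Lp.coeFn_add w w'] with ω hω h1
      rw [h1, Pi.add_apply, smul_add]
      exact hω.add_le _ _)
    (by
      rintro ⟨_, v, rfl⟩
      rw [hf]
      exact (hz v).trans (hST v).ge)
  have hgT : ∀ v, g (T v) = inner ℝ z v := fun v =>
    (hgf ⟨T v, LinearMap.mem_range_self T v⟩).trans (hf v)
  let g' : Lp E 2 P →L[ℝ] ℝ := g.mkContinuous ‖hr.toLp r‖ fun w => by
    refine abs_le.2 ⟨?_, (hgS w).trans (hS_le w)⟩
    have := (hgS (-w)).trans (hS_le (-w))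
    rw [map_neg, norm_neg] at this
    linarith
  let η : Lp E 2 P := (InnerProductSpace.toDual ℝ (Lp E 2 P)).symm g'
  have hη : ∀ w, ∫ ω, inner ℝ (η ω) (w ω) ∂P = g w := fun w => by
    rw [← L2.inner_def]
    exact InnerProductSpace.toDual_symm_apply
  have hξm : AEStronglyMeasurable (fun ω => r ω • η ω) P := hrm.smul (Lp.aestronglyMeasurable η)
  have hξ : Integrable (fun ω => r ω • η ω) P := by
    refine (hdom η).mono' hξm (.of_forall fun ω => ?_)
    rw [norm_smul, Real.norm_of_nonneg (hr0 ω).le]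
  refine ⟨fun ω => r ω • η ω, hξ, ?_, ?_⟩
  · have hv : ∀ v, ∀ᵐ ω ∂P, inner ℝ (r ω • η ω) v ≤ σ ω v := fun v => by
      refine ae_le_of_forall_setIntegral_le (hξ.inner_const v) (h.integrable hk v) fun A hA _ => ?_
      have hA2 : MemLp (A.indicator fun ω => r ω • v) 2 P := (hmem v).indicator hA
      rw [← integral_indicator hA, ← integral_indicator hA]
      calc ∫ ω, A.indicator (fun ω => inner ℝ (r ω • η ω) v) ω ∂P
          = ∫ ω, inner ℝ (η ω) (hA2.toLp _ ω) ∂P := by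
            refine integral_congr_ae ?_
            filter_upwards [hA2.coeFn_toLp] with ω hω
            rw [hω]
            by_cases hmemA : ω ∈ A <;> simp [hmemA, real_inner_smul_left, real_inner_smul_right]
        _ ≤ S (hA2.toLp _) := (hη _).le.trans (hgS _)
        _ = ∫ ω, A.indicator (fun ω => σ ω v) ω ∂P := by
            refine integral_congr_ae ?_
            filter_upwards [hA2.coeFn_toLp, h.sublinear] with ω hω hσ
            rw [hω]
            by_cases hmemA : ω ∈ A
            · simp only [Set.indicator_of_mem hmemA]
              rw [inv_smul_smul₀ (hr0 ω).ne']
            · simp only [Set.indicator_of_notMem hmemA, smul_zero, hσ.map_zero]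
    filter_upwards [ae_all_iff.2 fun n : ℕ => hv (TopologicalSpace.denseSeq E n), h.sublinear]
      with ω hω hσ v
    refine (TopologicalSpace.denseRange_denseSeq E).induction_on v ?_ hω
    exact isClosed_le (by fun_prop) hσ.continuous
  · refine ext_inner_right ℝ fun v => ?_
    rw [← hgT v, ← hη, real_inner_comm, ← integral_inner hξ]
    refine integral_congr_ae ?_
    filter_upwards [hTcoe v] with ω hω
    rw [hω, real_inner_smul_right, real_inner_smul_right, real_inner_comm]

/-- A bounded sublinear function has a linear minorant. -/
theorem IsBoundedSublinear.exists_inner_le [CompleteSpace E] {σ : E → ℝ} {k : ℝ}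
    (h : IsBoundedSublinear σ k) : ∃ z : E, ∀ v : E, inner ℝ z v ≤ σ v := by
  obtain ⟨g, -, hg⟩ := exists_extension_of_le_sublinear (⊥ : E →ₗ.[ℝ] ℝ) σ h.smul_eq h.add_le
    (by
      rintro ⟨x, hx⟩
      obtain rfl : x = 0 := hx
      rw [h.map_zero]
      exact (_root_.map_zero (⊥ : E →ₗ.[ℝ] ℝ).toFun).le)
  let g' : E →L[ℝ] ℝ := g.mkContinuous k fun v => by
    refine _root_.abs_le.2 ⟨?_, (hg v).trans (_root_.abs_le.1 (h.abs_le v)).2⟩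
    have := (hg (-v)).trans (_root_.abs_le.1 (h.abs_le (-v))).2
    rw [map_neg, norm_neg] at this
    linarith
  refine ⟨(InnerProductSpace.toDual ℝ E).symm g', fun v => ?_⟩
  rw [InnerProductSpace.toDual_symm_apply]
  exact hg v

theorem IsBoundedSublinear.norm_le {σ : E → ℝ} {k : ℝ} (hk : 0 ≤ k)
    (h : IsBoundedSublinear σ k) {z : E} (hz : ∀ v : E, inner ℝ z v ≤ σ v) : ‖z‖ ≤ k := by
  have h1 := (hz z).trans (_root_.abs_le.1 (h.abs_le z)).2
  rw [real_inner_self_eq_norm_sq, sq] at h1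
  rcases (norm_nonneg z).eq_or_lt with h0 | h0
  · rwa [← h0]
  · exact le_of_mul_le_mul_right h1 h0

end Selection

/-! ### Exchange of generalized gradients and expectations -/

section Exchange

variable {Ω E : Type*} [MeasurableSpace Ω] {P : Measure Ω} [NormedAddCommGroup E]
  [InnerProductSpace ℝ E]

theorem HasRegularDeriv.isBoundedSublinear {f : E → ℝ} {x : E} {σ : E → ℝ}
    (h : HasRegularDeriv f x σ) {U : Set E} (hU : U ∈ 𝓝 x) {k : ℝ}
    (hk : ∀ y ∈ U, ∀ z ∈ U, |f y - f z| ≤ k * ‖y - z‖) : IsBoundedSublinear σ k :=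
  ⟨fun _ ha v => h.smul_eq ha v, h.add_le, h.abs_le hU hk⟩

theorem HasRegularDeriv.clarkeGradient_neg {f : E → ℝ} {x : E} {σ : E → ℝ}
    (h : HasRegularDeriv f x σ) :
    clarkeGradient (fun y => -f y) x = {ξ : E | ∀ v : E, inner ℝ ξ v ≤ σ (-v)} := by
  ext ξ
  simp only [clarkeGradient, Set.mem_ofPred_eq, clarkeDeriv_neg, h.clarkeDeriv_eq,
    EReal.coe_le_coe_iff]

theorem HasRegularDeriv.clarkeRegularAt {f : E → ℝ} {x : E} {σ : E → ℝ}
    (h : HasRegularDeriv f x σ) (hf : LipschitzNear f x) : ClarkeRegularAt f x :=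
  ⟨hf, fun v => by
    rw [h.clarkeDeriv_eq]
    exact (continuous_coe_real_ereal.tendsto _).comp (h.tendsto v)⟩

omit [InnerProductSpace ℝ E] in
theorem lipschitzNear_of_abs_sub_le {f : E → ℝ} {x : E} {U : Set E} (hU : U ∈ 𝓝 x) {k : ℝ}
    (hk : ∀ y ∈ U, ∀ z ∈ U, |f y - f z| ≤ k * ‖y - z‖) : LipschitzNear f x := by
  refine ⟨k.toNNReal, U, hU, LipschitzOnWith.of_dist_le_mul fun y hy z hz => ?_⟩
  rw [Real.dist_eq, dist_eq_norm]
  exact (hk y hy z hz).trans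
    (mul_le_mul_of_nonneg_right (Real.le_coe_toNNReal k) (norm_nonneg _))

variable {ψ : E → Ω → ℝ} {θ : E} {U : Set E} {k : Ω → ℝ}

omit [InnerProductSpace ℝ E] in
theorem integrable_of_abs_sub_le (hU : U ∈ 𝓝 θ) (hk : Integrable k P)
    (hmeas : ∀ y ∈ U, AEStronglyMeasurable (ψ y) P) (hint : Integrable (ψ θ) P)
    (hLip : ∀ᵐ ω ∂P, ∀ y ∈ U, ∀ z ∈ U, |ψ y ω - ψ z ω| ≤ k ω * ‖y - z‖) {y : E} (hy : y ∈ U) :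
    Integrable (ψ y) P := by
  have h : Integrable (fun ω => ψ y ω - ψ θ ω) P := by
    refine (hk.mul_const ‖y - θ‖).mono' ((hmeas y hy).sub hint.1) ?_
    filter_upwards [hLip] with ω hω
    exact hω y hy θ (mem_of_mem_nhds hU)
  refine (h.add hint).congr (.of_forall fun ω => ?_)
  simp

omit [InnerProductSpace ℝ E] in
theorem abs_integral_sub_le (hU : U ∈ 𝓝 θ) (hk : Integrable k P)
    (hmeas : ∀ y ∈ U, AEStronglyMeasurable (ψ y) P) (hint : Integrable (ψ θ) P)
    (hLip : ∀ᵐ ω ∂P, ∀ y ∈ U, ∀ z ∈ U, |ψ y ω - ψ z ω| ≤ k ω * ‖y - z‖) :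
    ∀ y ∈ U, ∀ z ∈ U, |∫ ω, ψ y ω ∂P - ∫ ω, ψ z ω ∂P| ≤ (∫ ω, k ω ∂P) * ‖y - z‖ := by
  intro y hy z hz
  rw [← integral_sub (integrable_of_abs_sub_le hU hk hmeas hint hLip hy)
    (integrable_of_abs_sub_le hU hk hmeas hint hLip hz), ← integral_mul_const,
    ← Real.norm_eq_abs]
  refine norm_integral_le_of_norm_le (hk.mul_const _) ?_
  filter_upwards [hLip] with ω hω
  exact hω y hy z hz

/-- Expectations of regular functions are regular, and the directional derivatives may be computed
under the expectation.  For the upper bound, the maximum of the difference quotient and `σ`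
converges to `σ`, and dominated convergence applies to it. -/
theorem hasRegularDeriv_integral (hU : U ∈ 𝓝 θ) (hk : Integrable k P)
    (hmeas : ∀ y ∈ U, AEStronglyMeasurable (ψ y) P) (hint : Integrable (ψ θ) P)
    (hLip : ∀ᵐ ω ∂P, ∀ y ∈ U, ∀ z ∈ U, |ψ y ω - ψ z ω| ≤ k ω * ‖y - z‖)
    {σ : Ω → E → ℝ} (hreg : ∀ᵐ ω ∂P, HasRegularDeriv (fun y => ψ y ω) θ (σ ω)) :
    IsRandomSublinear P σ k ∧
      HasRegularDeriv (fun y => ∫ ω, ψ y ω ∂P) θ (fun v => ∫ ω, σ ω v ∂P) := by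
  have hi := fun y (hy : y ∈ U) => integrable_of_abs_sub_le hU hk hmeas hint hLip hy
  have hseg : ∀ v : E, ∀ᶠ p : E × ℝ in 𝓝 θ ×ˢ 𝓝[>] 0,
      0 < p.2 ∧ p.1 ∈ U ∧ p.1 + p.2 • v ∈ U := fun v => by
    filter_upwards [eventually_snd_pos θ, tendsto_fst.eventually hU,
      (tendsto_fst.comp (tendsto_translate_prod θ v)).eventually hU] with p h1 h2 h3
    exact ⟨h1, h2, h3⟩
  have hpair : Tendsto (fun t : ℝ => (θ, t)) (𝓝[>] 0) (𝓝 θ ×ˢ 𝓝[>] 0) :=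
    tendsto_const_nhds.prodMk tendsto_id
  have hquot : ∀ v : E, ∀ p : E × ℝ, 0 < p.2 → p.1 ∈ U → p.1 + p.2 • v ∈ U →
      ∀ᵐ ω ∂P, |(ψ (p.1 + p.2 • v) ω - ψ p.1 ω) / p.2| ≤ k ω * ‖v‖ := fun v p h1 h2 h3 => by
    filter_upwards [hLip] with ω hω
    rw [abs_div, abs_of_pos h1, div_le_iff₀ h1]
    refine (hω _ h3 _ h2).trans (le_of_eq ?_)
    rw [add_sub_cancel_left, norm_smul, Real.norm_of_nonneg h1.le]
    ring
  have hqmeas : ∀ v : E, ∀ p : E × ℝ, p.1 ∈ U → p.1 + p.2 • v ∈ U →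
      AEStronglyMeasurable (fun ω => (ψ (p.1 + p.2 • v) ω - ψ p.1 ω) / p.2) P :=
    fun v p h2 h3 => by
    simp only [div_eq_mul_inv]
    exact ((hmeas _ h3).sub (hmeas _ h2)).mul_const _
  have hqint : ∀ v : E, ∀ p : E × ℝ, p.1 ∈ U → p.1 + p.2 • v ∈ U →
      ∫ ω, (ψ (p.1 + p.2 • v) ω - ψ p.1 ω) / p.2 ∂P
        = (∫ ω, ψ (p.1 + p.2 • v) ω ∂P - ∫ ω, ψ p.1 ω ∂P) / p.2 := fun v p h2 h3 => by
    rw [integral_div, integral_sub (hi _ h3) (hi _ h2)]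
  have hrand : IsRandomSublinear P σ k := by
    refine ⟨fun v => ?_, ?_⟩
    · -- where `θ + t • v ∉ U` the quotient need not be measurable, so it is replaced by `0`
      let q : ℝ → Ω → ℝ := fun t ω =>
        open Classical in if θ + t • v ∈ U then (ψ (θ + t • v) ω - ψ θ ω) / t else 0
      refine aestronglyMeasurable_of_tendsto_ae (𝓝[>] (0 : ℝ)) (f := q) (fun t => ?_) ?_
      · by_cases ht : θ + t • v ∈ U
        · simp only [q, if_pos ht]
          exact hqmeas v (θ, t) (mem_of_mem_nhds hU) ht
        · simp only [q, if_neg ht]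
          exact aestronglyMeasurable_const
      · filter_upwards [hreg] with ω hω
        refine (hω.tendsto v).congr' ?_
        filter_upwards [hpair.eventually (hseg v)] with t ht
        simp only [q, if_pos ht.2.2]
    · filter_upwards [hreg, hLip] with ω h1 h2
      exact h1.isBoundedSublinear hU h2
  refine ⟨hrand, fun v => ?_, fun v r hr => ?_⟩
  · have h1 : Tendsto (fun t : ℝ => ∫ ω, (ψ (θ + t • v) ω - ψ θ ω) / t ∂P) (𝓝[>] 0)
        (𝓝 (∫ ω, σ ω v ∂P)) := by
      refine tendsto_integral_filter_of_dominated_convergence (fun ω => k ω * ‖v‖) ?_ ?_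
        (hk.mul_const _) ?_
      · filter_upwards [hpair.eventually (hseg v)] with t ht
        exact hqmeas v (θ, t) ht.2.1 ht.2.2
      · filter_upwards [hpair.eventually (hseg v)] with t ht
        exact hquot v (θ, t) ht.1 ht.2.1 ht.2.2
      · filter_upwards [hreg] with ω hω
        exact hω.tendsto v
    refine h1.congr' ?_
    filter_upwards [hpair.eventually (hseg v)] with t ht
    exact hqint v (θ, t) ht.2.1 ht.2.2
  · have hmaxm : ∀ p : E × ℝ, p.1 ∈ U → p.1 + p.2 • v ∈ U → AEStronglyMeasurable
        (fun ω => max ((ψ (p.1 + p.2 • v) ω - ψ p.1 ω) / p.2) (σ ω v)) P := fun p h2 h3 =>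
      (hqmeas v p h2 h3).sup (hrand.aestronglyMeasurable v)
    have hmaxb : ∀ p : E × ℝ, 0 < p.2 → p.1 ∈ U → p.1 + p.2 • v ∈ U → ∀ᵐ ω ∂P,
        ‖max ((ψ (p.1 + p.2 • v) ω - ψ p.1 ω) / p.2) (σ ω v)‖ ≤ k ω * ‖v‖ := fun p h1 h2 h3 => by
      filter_upwards [hquot v p h1 h2 h3, hrand.sublinear] with ω h4 h5
      exact abs_max_le_max_abs_abs.trans (max_le h4 (h5.abs_le v))
    have h1 : Tendsto (fun p : E × ℝ =>
        ∫ ω, max ((ψ (p.1 + p.2 • v) ω - ψ p.1 ω) / p.2) (σ ω v) ∂P) (𝓝 θ ×ˢ 𝓝[>] 0)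
        (𝓝 (∫ ω, σ ω v ∂P)) := by
      refine tendsto_integral_filter_of_dominated_convergence (fun ω => k ω * ‖v‖) ?_ ?_
        (hk.mul_const _) ?_
      · filter_upwards [hseg v] with p hp
        exact hmaxm p hp.2.1 hp.2.2
      · filter_upwards [hseg v] with p hp
        exact hmaxb p hp.1 hp.2.1 hp.2.2
      · filter_upwards [hreg] with ω hω
        refine tendsto_order.2 ⟨fun a ha => .of_forall fun p => lt_max_of_lt_right ha,
          fun a ha => ?_⟩
        filter_upwards [hω.eventually_lt v a ha] with p hp
        exact max_lt hp ha
    filter_upwards [h1.eventually_lt_const hr, hseg v] with p hp hs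
    rw [← hqint v p hs.2.1 hs.2.2]
    refine lt_of_le_of_lt (integral_mono_ae ?_ ?_ (.of_forall fun ω => le_max_left _ _)) hp
    · exact (hk.mul_const _).mono' (hqmeas v p hs.2.1 hs.2.2) (hquot v p hs.1 hs.2.1 hs.2.2)
    · exact (hk.mul_const _).mono' (hmaxm p hs.2.1 hs.2.2) (hmaxb p hs.1 hs.2.1 hs.2.2)

/-- If the negatives of random functions are regular at `θ` and Lipschitz near `θ` with an integrable
constant, generalized gradients commute with the expectation. -/
theorem clarkeGradient_integral [IsProbabilityMeasure P] [CompleteSpace E]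
    [TopologicalSpace.SeparableSpace E] {h : E → Ω → ℝ} (hU : U ∈ 𝓝 θ) (hk : Integrable k P)
    (hk0 : ∀ ω, 0 ≤ k ω) (hmeas : ∀ y ∈ U, AEStronglyMeasurable (h y) P)
    (hint : Integrable (h θ) P)
    (hLip : ∀ᵐ ω ∂P, ∀ y ∈ U, ∀ z ∈ U, |h y ω - h z ω| ≤ k ω * ‖y - z‖)
    (hreg : ∀ᵐ ω ∂P, ∃ σ, HasRegularDeriv (fun y => -h y ω) θ σ) :
    (∀ᵐ ω ∂P, LipschitzNear (fun y => h y ω) θ) ∧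
    (∀ᵐ ω ∂P, ∀ ξ ∈ clarkeGradient (fun y => h y ω) θ, ‖ξ‖ ≤ k ω) ∧
    clarkeGradient (fun y => ∫ ω, h y ω ∂P) θ
      = setExpectation P (fun ω => clarkeGradient (fun y => h y ω) θ) ∧
    (clarkeGradient (fun y => ∫ ω, h y ω ∂P) θ).Nonempty ∧
    Bornology.IsBounded (clarkeGradient (fun y => ∫ ω, h y ω ∂P) θ) ∧
    ClarkeRegularAt (fun y => -∫ ω, h y ω ∂P) θ := by
  classical
  let σ : Ω → E → ℝ := fun ω =>
    if hω : ∃ s, HasRegularDeriv (fun y => -h y ω) θ s then hω.choose else 0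
  have hσ : ∀ᵐ ω ∂P, HasRegularDeriv (fun y => -h y ω) θ (σ ω) := by
    filter_upwards [hreg] with ω hω
    simp only [σ, dif_pos hω]
    exact hω.choose_spec
  have hLip' : ∀ᵐ ω ∂P, ∀ y ∈ U, ∀ z ∈ U, |-h y ω - -h z ω| ≤ k ω * ‖y - z‖ := by
    filter_upwards [hLip] with ω hω y hy z hz
    rw [neg_sub_neg, abs_sub_comm]
    exact hω y hy z hz
  obtain ⟨hrand, hint_reg⟩ := hasRegularDeriv_integral (ψ := fun y ω => -h y ω) hU hk
    (fun y hy => (hmeas y hy).neg) hint.neg hLip' hσ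
  have hLipI := abs_integral_sub_le (ψ := fun y ω => -h y ω) hU hk
    (fun y hy => (hmeas y hy).neg) hint.neg hLip'
  -- the sublinear functions that define the gradients of `h` itself
  have hrand' : IsRandomSublinear P (fun ω v => σ ω (-v)) k :=
    ⟨fun v => hrand.aestronglyMeasurable (-v), hrand.sublinear.mono fun ω hω => hω.comp_neg⟩
  have hsub := hrand'.isBoundedSublinear_integral hk
  have hgrad : ∀ᵐ ω ∂P, clarkeGradient (fun y => h y ω) θ
      = {ξ : E | ∀ v : E, inner ℝ ξ v ≤ σ ω (-v)} := by
    filter_upwards [hσ] with ω hω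
    simpa only [neg_neg] using hω.clarkeGradient_neg
  have hgradI : clarkeGradient (fun y => ∫ ω, h y ω ∂P) θ
      = {ξ : E | ∀ v : E, inner ℝ ξ v ≤ ∫ ω, σ ω (-v) ∂P} := by
    simpa only [integral_neg, neg_neg] using hint_reg.clarkeGradient_neg
  simp only [integral_neg] at hint_reg hLipI
  refine ⟨?_, ?_, ?_, ?_, ?_, hint_reg.clarkeRegularAt (lipschitzNear_of_abs_sub_le hU hLipI)⟩
  · filter_upwards [hLip] with ω hω
    exact lipschitzNear_of_abs_sub_le hU hω
  · filter_upwards [hgrad, hrand'.sublinear] with ω hω hs ξ hξ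
    rw [hω] at hξ
    exact hs.norm_le (hk0 ω) hξ
  · rw [hgradI]
    ext z
    constructor
    · intro hz
      obtain ⟨ξ, hξ, hξσ, rfl⟩ := hrand'.exists_selection hk hk0 hz
      refine ⟨ξ, hξ, ?_, rfl⟩
      filter_upwards [hξσ, hgrad] with ω h1 h2
      rw [h2]
      exact h1
    · rintro ⟨ξ, hξ, hξσ, rfl⟩ v
      rw [real_inner_comm, ← integral_inner hξ]
      refine integral_mono_ae (hξ.const_inner v) (hrand'.integrable hk v) ?_
      filter_upwards [hξσ, hgrad] with ω h1 h2
      rw [h2] at h1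
      rw [real_inner_comm]
      exact h1 v
  · rw [hgradI]
    exact hsub.exists_inner_le
  · rw [hgradI]
    refine isBounded_iff_forall_norm_le.2 ⟨∫ ω, k ω ∂P, fun z hz => ?_⟩
    exact hsub.norm_le (integral_nonneg hk0) hz

end Exchange

/-! ### The losses as functions of the points -/

section Loss

variable {m : ℕ} {φ : ℝ≥0 → ℝ≥0∞} {τ ε : ℝ≥0} {F : Type*} {c : F → F → ℝ}

/-- The costs between two tuples of points, as an element of a normed space. -/
def costFun (c : F → F → ℝ) (x y : Fin m → F) : Fin m → Fin m → ℝ := fun i j => c (x i) (y j)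

/-- The loss for uniform weights as a real number, by `loss_eq_realLoss`. -/
noncomputable def realLoss (L : LossKind) (φ : ℝ≥0 → ℝ≥0∞) (τ ε : ℝ≥0) (c : F → F → ℝ)
    (x y : Fin m → F) : ℝ :=
  match L with
  | LossKind.transport => lowerEnvelope (planFamily m φ τ ε) (costFun c x y)
  | LossKind.sinkhorn => lowerEnvelope (planFamily m φ τ ε) (costFun c x y)
      - 1 / 2 * lowerEnvelope (planFamily m φ τ ε) (costFun c x x)
      - 1 / 2 * lowerEnvelope (planFamily m φ τ ε) (costFun c y y)

theorem loss_eq_realLoss (hm : 0 < m) (hφ : IsEntropy φ) (hc : ∀ x y, 0 ≤ c x y) (L : LossKind)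
    (x y : Fin m → F) :
    loss L φ τ ε (uniformVec m) (uniformVec m) c x y = (realLoss L φ τ ε c x y : ℝ) := by
  have h : ∀ x y : Fin m → F, uot φ τ ε (uniformVec m) (uniformVec m) (costMatrix c x y)
      = (lowerEnvelope (planFamily m φ τ ε) (costFun c x y) : ℝ) := fun x y =>
    uot_eq_lowerEnvelope hm hφ fun i j => hc _ _
  cases L with
  | transport => exact h x y
  | sinkhorn =>
    simp only [loss, sinkhornDiv, realLoss]
    rw [h, h, h, sub_self, ← EReal.coe_mul, ← EReal.coe_mul, ← EReal.coe_add, ← EReal.coe_sub,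
      ← EReal.coe_sub]
    congr 1
    ring

theorem continuous_realLoss [TopologicalSpace F] (hm : 0 < m) (hφ : IsEntropy φ)
    (hc : Continuous fun p : F × F => c p.1 p.2) (L : LossKind) :
    Continuous fun p : (Fin m → F) × (Fin m → F) => realLoss L φ τ ε c p.1 p.2 := by
  have hg := (isBoundedFamily_planFamily (τ := τ) (ε := ε) hm hφ).continuous
  have hC : ∀ {a b : (Fin m → F) × (Fin m → F) → Fin m → F}, Continuous a → Continuous b →
      Continuous fun p => lowerEnvelope (planFamily m φ τ ε) (costFun c (a p) (b p)) :=
    fun {a b} ha hb => hg.comp (continuous_pi fun i => continuous_pi fun j =>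
      hc.comp (((continuous_apply i).comp ha).prodMk ((continuous_apply j).comp hb)))
  cases L with
  | transport => exact hC continuous_fst continuous_snd
  | sinkhorn =>
    exact ((hC continuous_fst continuous_snd).sub
      ((hC continuous_fst continuous_fst).const_mul _)).sub
        ((hC continuous_snd continuous_snd).const_mul _)

theorem abs_lowerEnvelope_sub_le (hm : 0 < m) (hφ : IsEntropy φ) {C C' : Fin m → Fin m → ℝ} {b : ℝ}
    (hb : 0 ≤ b) (h : ∀ i j, |C i j - C' i j| ≤ b) :
    |lowerEnvelope (planFamily m φ τ ε) C - lowerEnvelope (planFamily m φ τ ε) C'| ≤ m * b := by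
  refine ((isBoundedFamily_planFamily (τ := τ) (ε := ε) hm hφ).abs_sub_le C C').trans
    (mul_le_mul_of_nonneg_left ?_ (Nat.cast_nonneg m))
  exact (pi_norm_le_iff_of_nonneg hb).2 fun i => (pi_norm_le_iff_of_nonneg hb).2 fun j => h i j

theorem lowerEnvelope_costFun_self (hm : 0 < m) (hφ : IsEntropy φ) (hc : ∀ x y, 0 ≤ c x y)
    (hdiag : ∀ x, c x x = 0) (x : Fin m → F) :
    lowerEnvelope (planFamily m φ τ 0) (costFun c x x) = 0 :=
  lowerEnvelope_eq_zero_of_diag hm hφ (fun _ _ => hc _ _) fun _ => hdiag _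

theorem abs_realLoss_sub_le (hm : 0 < m) (hφ : IsEntropy φ) (hc : ∀ x y, 0 ≤ c x y)
    {L : LossKind} (hdiag : L = LossKind.sinkhorn → ε = 0 → ∀ x, c x x = 0)
    {x y y' : Fin m → F} {b : ℝ} (hb : 0 ≤ b)
    (h : ∀ i j, |costFun c x y i j - costFun c x y' i j| ≤ b)
    (h' : L = LossKind.sinkhorn → 0 < ε → ∀ i j, |costFun c y y i j - costFun c y' y' i j| ≤ b) :
    |realLoss L φ τ ε c x y - realLoss L φ τ ε c x y'| ≤ 2 * m * b := by
  have h1 := abs_lowerEnvelope_sub_le (τ := τ) (ε := ε) hm hφ hb h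
  have hmb : 0 ≤ m * b := by positivity
  cases L with
  | transport =>
    refine h1.trans ?_
    linarith
  | sinkhorn =>
    have h2 : |lowerEnvelope (planFamily m φ τ ε) (costFun c y y)
        - lowerEnvelope (planFamily m φ τ ε) (costFun c y' y')| ≤ m * b := by
      rcases eq_or_ne ε 0 with rfl | hε
      · rw [lowerEnvelope_costFun_self hm hφ hc (hdiag rfl rfl),
          lowerEnvelope_costFun_self hm hφ hc (hdiag rfl rfl)]
        simpa using hmb
      · exact abs_lowerEnvelope_sub_le hm hφ hb (h' rfl (pos_iff_ne_zero.2 hε))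
    simp only [realLoss]
    rw [abs_le] at h1 h2 ⊢
    constructor <;> linarith

/-- In `-h`, the cost between `x` and `y` contributes a convex function of a `C¹` map, hence a regular
term.  The term of the self-cost of `y` has the opposite sign and has to be strictly differentiable: it
is for `0 < ε`, and it vanishes for `ε = 0`. -/
theorem exists_hasRegularDeriv_neg_realLoss {E : Type*} [NormedAddCommGroup E]
    [InnerProductSpace ℝ E] [NormedAddCommGroup F] [NormedSpace ℝ F] (hm : 0 < m)
    (hφ : IsEntropy φ) (hc : ∀ x y, 0 ≤ c x y) (hc1 : ContDiff ℝ 1 fun p : F × F => c p.1 p.2)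
    {L : LossKind} (hdiag : L = LossKind.sinkhorn → ε = 0 → ∀ x, c x x = 0) (x : Fin m → F)
    {y : E → Fin m → F} {θ : E} (hy : ContDiffAt ℝ 1 y θ) :
    ∃ σ, HasRegularDeriv (fun θ' => -realLoss L φ τ ε c x (y θ')) θ σ := by
  have hS := isBoundedFamily_planFamily (τ := τ) (ε := ε) hm hφ
  have hyi : ∀ i, ContDiffAt ℝ 1 (fun θ' => y θ' i) θ := contDiffAt_pi.1 hy
  have hxy : ContDiffAt ℝ 1 (fun θ' => costFun c x (y θ')) θ :=
    contDiffAt_pi.2 fun i => contDiffAt_pi.2 fun j =>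
      hc1.contDiffAt.comp θ (contDiffAt_const.prodMk (hyi j))
  obtain ⟨σ, hσ⟩ := HasRegularDeriv.exists_of_convexOn_comp hS.convexOn_neg (K := m)
    (fun C C' => by
      rw [neg_sub_neg, abs_sub_comm]
      exact hS.abs_sub_le C C')
    (hxy.hasStrictFDerivAt one_ne_zero)
  cases L with
  | transport => exact ⟨σ, hσ⟩
  | sinkhorn =>
    have hyy : ∃ f' : E →L[ℝ] ℝ, HasStrictFDerivAt
        (fun θ' => lowerEnvelope (planFamily m φ τ ε) (costFun c (y θ') (y θ'))) f' θ := by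
      rcases eq_or_ne ε 0 with rfl | hε
      · refine ⟨0, ?_⟩
        have : (fun θ' => lowerEnvelope (planFamily m φ τ 0) (costFun c (y θ') (y θ')))
            = fun _ => 0 := funext fun θ' =>
          lowerEnvelope_costFun_self hm hφ hc (hdiag rfl rfl) (y θ')
        rw [this]
        exact hasStrictFDerivAt_const 0 θ
      · obtain ⟨g, hg⟩ := exists_hasStrictFDerivAt_lowerEnvelope (τ := τ) hm hφ
          (pos_iff_ne_zero.2 hε) (costFun c (y θ) (y θ))
        have h1 : ContDiffAt ℝ 1 (fun θ' => costFun c (y θ') (y θ')) θ :=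
          contDiffAt_pi.2 fun i => contDiffAt_pi.2 fun j =>
            hc1.contDiffAt.comp θ ((hyi i).prodMk (hyi j))
        exact ⟨_, hg.comp θ (h1.hasStrictFDerivAt one_ne_zero)⟩
    obtain ⟨f', hf'⟩ := hyy
    have h2 := HasRegularDeriv.of_hasStrictFDerivAt ((hf'.const_mul (1 / 2 : ℝ)).add_const
      (1 / 2 * lowerEnvelope (planFamily m φ τ ε) (costFun c x x)))
    have h3 := hσ.add h2
    refine ⟨_, h3.congr (.of_forall fun θ' => ?_)⟩
    simp only [realLoss]
    ring

end Loss

end UOT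

theorem theorem2 {Ω : Type*} [MeasurableSpace Ω] (P : Measure Ω) [IsProbabilityMeasure P]
    (m d q : ℕ) (hm : 0 < m)
    -- the entropy, the marginal penalization, the regularization (possibly 0) and the loss
    (φ : ℝ≥0 → ℝ≥0∞) (hφ : UOT.IsEntropy φ) (τ ε : ℝ≥0) (hτ : 0 < τ) (L : UOT.LossKind)
    -- the ground cost
    (c : EuclideanSpace ℝ (Fin d) → EuclideanSpace ℝ (Fin d) → ℝ)
    (hc : ContDiff ℝ 1
      (fun p : EuclideanSpace ℝ (Fin d) × EuclideanSpace ℝ (Fin d) => c p.1 p.2))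
    (hc_nonneg : ∀ x y, 0 ≤ c x y)
    (hc_diag : L = UOT.LossKind.sinkhorn → ε = 0 → ∀ x, c x x = 0)
    -- the parameters and the random minibatches
    (Θ : Set (EuclideanSpace ℝ (Fin q))) (hΘ : IsOpen Θ)
    (X : Ω → Fin m → EuclideanSpace ℝ (Fin d))
    (Y : EuclideanSpace ℝ (Fin q) → Ω → Fin m → EuclideanSpace ℝ (Fin d))
    (hX : Measurable X) (hY : ∀ θ ∈ Θ, Measurable (Y θ))
    (hX_supp : ∃ K : Set (Fin m → EuclideanSpace ℝ (Fin d)), IsCompact K ∧ ∀ᵐ ω ∂P, X ω ∈ K)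
    (hY_supp : ∀ θ ∈ Θ, ∃ K : Set (Fin m → EuclideanSpace ℝ (Fin d)),
      IsCompact K ∧ ∀ᵐ ω ∂P, Y θ ω ∈ K)
    (hY_smooth : ∀ᵐ ω ∂P, ContDiffOn ℝ 1 (fun θ => Y θ ω) Θ)
    -- integrable local Lipschitz bounds on the cost matrices that the loss depends on
    (hLip : ∀ θ ∈ Θ, ∃ U : Set (EuclideanSpace ℝ (Fin q)), IsOpen U ∧ θ ∈ U ∧ U ⊆ Θ ∧
      ∃ K : Ω → ℝ, Integrable K P ∧ ∀ᵐ ω ∂P, ∀ θ₁ ∈ U, ∀ θ₂ ∈ U, ∀ i j,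
        |UOT.costMatrix c (X ω) (Y θ₁ ω) i j - UOT.costMatrix c (X ω) (Y θ₂ ω) i j|
            ≤ K ω * ‖θ₁ - θ₂‖ ∧
        (L = UOT.LossKind.sinkhorn → 0 < ε →
          |UOT.costMatrix c (Y θ₁ ω) (Y θ₁ ω) i j - UOT.costMatrix c (Y θ₂ ω) (Y θ₂ ω) i j|
            ≤ K ω * ‖θ₁ - θ₂‖)) :
    let H : EuclideanSpace ℝ (Fin q) → Ω → EReal := fun θ ω =>
      UOT.loss L φ τ ε (UOT.uniformVec m) (UOT.uniformVec m) c (X ω) (Y θ ω)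
    let h : EuclideanSpace ℝ (Fin q) → Ω → ℝ := fun θ ω => (H θ ω).toReal
    ∀ θ ∈ Θ,
      -- the expected loss is finite
      (∀ᵐ ω ∂P, H θ ω ≠ ⊥ ∧ H θ ω ≠ ⊤) ∧
      Integrable (h θ) P ∧
      -- the random generalized gradients are integrably bounded
      (∀ᵐ ω ∂P, UOT.LipschitzNear (fun θ' => h θ' ω) θ) ∧
      (∃ k : Ω → ℝ, Integrable k P ∧
        ∀ᵐ ω ∂P, ∀ ξ ∈ UOT.clarkeGradient (fun θ' => h θ' ω) θ, ‖ξ‖ ≤ k ω) ∧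
      -- exchange of generalized gradient and expectation, both sides being finite
      UOT.clarkeGradient (fun θ' => ∫ ω, h θ' ω ∂P) θ
        = UOT.setExpectation P (fun ω => UOT.clarkeGradient (fun θ' => h θ' ω) θ) ∧
      (UOT.clarkeGradient (fun θ' => ∫ ω, h θ' ω ∂P) θ).Nonempty ∧
      Bornology.IsBounded (UOT.clarkeGradient (fun θ' => ∫ ω, h θ' ω ∂P) θ) ∧
      -- Clarke regularity
      UOT.ClarkeRegularAt (fun θ' => -∫ ω, h θ' ω ∂P) θ := by
  intro H h θ hθ
  have hH : ∀ θ' ω, H θ' ω = (UOT.realLoss L φ τ ε c (X ω) (Y θ' ω) : ℝ) := fun θ' ω =>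
    UOT.loss_eq_realLoss hm hφ hc_nonneg L _ _
  have hh : ∀ θ' ω, h θ' ω = UOT.realLoss L φ τ ε c (X ω) (Y θ' ω) := fun θ' ω => by
    simp only [h, hH, EReal.toReal_coe]
  have hcont := UOT.continuous_realLoss (τ := τ) (ε := ε) hm hφ hc.continuous L
  have hmeas : ∀ θ' ∈ Θ, AEStronglyMeasurable (h θ') P := fun θ' hθ' => by
    rw [funext (hh θ')]
    exact (hcont.measurable.comp (hX.prodMk (hY θ' hθ'))).aestronglyMeasurable
  have hint : Integrable (h θ) P := by
    obtain ⟨K₁, hK₁, hX₁⟩ := hX_supp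
    obtain ⟨K₂, hK₂, hY₂⟩ := hY_supp θ hθ
    obtain ⟨B, hB⟩ := (hK₁.prod hK₂).exists_bound_of_continuousOn hcont.continuousOn
    refine Integrable.of_bound (hmeas θ hθ) B ?_
    filter_upwards [hX₁, hY₂] with ω h₁ h₂
    rw [hh]
    exact hB (X ω, Y θ ω) ⟨h₁, h₂⟩
  obtain ⟨U, hU, hθU, hUΘ, K, hK, hKLip⟩ := hLip θ hθ
  have hk : Integrable (fun ω => 2 * m * |K ω|) P := hK.abs.const_mul _
  have hLip' : ∀ᵐ ω ∂P, ∀ θ₁ ∈ U, ∀ θ₂ ∈ U,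
      |h θ₁ ω - h θ₂ ω| ≤ 2 * m * |K ω| * ‖θ₁ - θ₂‖ := by
    filter_upwards [hKLip] with ω hω θ₁ h₁ θ₂ h₂
    have hle : K ω * ‖θ₁ - θ₂‖ ≤ |K ω| * ‖θ₁ - θ₂‖ :=
      mul_le_mul_of_nonneg_right (le_abs_self _) (norm_nonneg _)
    rw [hh, hh, mul_assoc]
    exact UOT.abs_realLoss_sub_le hm hφ hc_nonneg hc_diag (by positivity)
      (fun i j => ((hω θ₁ h₁ θ₂ h₂ i j).1).trans hle)
      (fun hL hε i j => ((hω θ₁ h₁ θ₂ h₂ i j).2 hL hε).trans hle)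
  have hreg : ∀ᵐ ω ∂P, ∃ σ, UOT.HasRegularDeriv (fun θ' => -h θ' ω) θ σ := by
    filter_upwards [hY_smooth] with ω hω
    simp only [hh]
    exact UOT.exists_hasRegularDeriv_neg_realLoss hm hφ hc_nonneg hc hc_diag (X ω)
      (hω.contDiffAt (hΘ.mem_nhds hθ))
  obtain ⟨h1, h2, h3⟩ := UOT.clarkeGradient_integral (hU.mem_nhds hθU) hk
    (fun ω => by positivity) (fun θ' hθ' => hmeas θ' (hUΘ hθ')) hint hLip' hreg
  refine ⟨.of_forall fun ω => ?_, hint, h1, ⟨_, hk, h2⟩, h3⟩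
  rw [hH]
  exact ⟨EReal.coe_ne_bot _, EReal.coe_ne_top _⟩
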